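/- Let $S$ and $A$ be nonempty standard Borel spaces, and let $K\subseteq S\times A$ be a measurable set that contains the graph of a measurable map $S\to A$; write $A(x)=\{a:(x,a)\in K\}$. Let $q(dy|x,a)$ be a signed kernel on $S$ given $(x,a)\in K$ with $q(\Gamma\setminus\{x\}|x,a)\ge 0$ for all measurable $\Gamma\subseteq S$, $q(S|x,a)=0$, and $\sup_{a\in A(x)}q_x(a)<\infty$ for each $x\in S$, where $q_x(a):=-q(\{x\}|x,a)$. Let $c:K\to[0,\infty)$ be measurable. A Markov policy is a stochastic kernel $\pi(da|x,t)$ on $A$ given $x\in S$ and time $t$, concentrated on $A(x)$; it is stationary if it does not depend on $t$, and is then written $\pi(da|x)$. Under a Markov policy $\pi$ and an initial distribution $\gamma$ on $S$, let $P^\pi_\gamma$ ($P^\pi_x$ if $\gamma=\delta_x$) be the law of the marked point process $(t_n,x_n)_{n\ge 0}$ with $t_0=0$, $x_0\sim\gamma$, for which, given the past up to the $n$-th jump with $t_n<\infty$, the next jump takes place in $ds$ and leads into $dy\subseteq S$ with probability $$I\{s>t_n\}\,e^{-\int_{t_n}^s\int_A q_{x_n}(a)\pi(da|x_n,\theta)d\theta}\int_A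 q(dy\setminus\{x_n\}|x_n,a)\pi(da|x_n,s)\,ds,$$ and $(t_{n+1},x_{n+1})=(\infty,x_\infty)$ with the remaining probability, as well as when $t_n=\infty$; here $x_\infty\notin S$ is a cemetery point. Put $\xi_t=x_n$ for $t_n\le t<t_{n+1}$, and $\xi_t=x_\infty$ for $t\ge\lim_n t_n$. For $x\in S$ and $0\le u\le t$ let $p^\pi(u,x,t,dy)$ be the conditional law $P^\pi_x(\xi_t\in dy\,|\,\xi_u=x)$ on $S$ (where $P_x^\pi(\xi_u=x)>0$), and define $$W^\pi(u,x,t)=\int_u^t\int_S\int_A c(y,a)\pi(da|y,s)\,p^\pi(u,x,s,dy)\,ds,$$ $$W(x,\pi)=\limsup_{T\to\infty}\frac1T E^\pi_x\Big[\int_0^T\int_A c(\xi_t,a)\pi(da|\xi_t,t)\,dt\Big],$$ with zero cost in $x_\infty$. The convention $0\cdot\infty=0$ is used. (a) Let $\pi$ be a Markov policy. Then $p^\pi$ is the transition function of $\xi$: it is a sub-probability kernel in $x$, and for every initial distribution $\gamma$ and $0\le u\le t$, $P^\pi_\gamma(\xi_t\in dy|\xi_u)=p^\pi(u,\xi_u,t,dy)$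 on $S$, $P^\pi_\gamma$-a.s. on $\{\xi_u\in S\}$. Moreover $W^\pi$ is the minimal $[0,\infty]$-valued measurable solution of the inequality, for all $x\in S$ and $0\le u\le t$, $$\begin{aligned}v(u,x,t)\ \ge\ & \int_u^t\int_A c(x,a)\pi(da|x,\theta)d\theta\; e^{-\int_u^t\int_A q_x(a)\pi(da|x,\theta)d\theta}\\ &+\int_u^t e^{-\int_u^s\int_A q_x(a)\pi(da|x,\theta)d\theta}\Big\{\int_A q_x(a)\pi(da|x,s)\int_u^s\int_A c(x,a)\pi(da|x,\theta)d\theta\\ &\qquad+\int_{S\setminus\{x\}}\int_A q(dy|x,a)\pi(da|x,s)\,v(s,y,t)\Big\}ds;\end{aligned}$$ that is, $W^\pi$ is measurable and satisfies the inequality, and $v\ge W^\pi$ pointwise for every measurable $v\ge 0$ that satisfies it. (b) Let $\pi$ be a stationary policy, and let $g\in[0,\infty]$ and a measurable $h:S\to[0,\infty]$ satisfy, for each $x\in S$, $$g+h(x)\int_A q_x(a)\pi(da|x)\ \ge\ \int_A c(x,a)\pi(da|x)+\int_{S\setminus\{x\}}h(y)\int_A q(dy|x,a)\pi(da|x).$$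 Then $g\ge W(x,\pi)$ for each $x\in S$ with $h(x)<\infty$. -/

import Mathlib

open MeasureTheory ProbabilityTheory Set Filter Topology
open scoped ENNReal NNReal

/-- A kernel all of whose measures are finite (not necessarily with a common bound) is s-finite. -/
theorem isSFiniteKernel_of_forall_lt_top {α β : Type*} [MeasurableSpace α] [MeasurableSpace β]
    (κ : Kernel α β) (h : ∀ a, κ a univ < ∞) : IsSFiniteKernel κ := by
  classical
  have hmeas : Measurable fun a => κ a univ := κ.measurable_coe MeasurableSet.univ
  let s : ℕ → Set α := fun n => {a | (n : ℝ≥0∞) ≤ κ a univ ∧ κ a univ < n + 1}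
  have hs : ∀ n, MeasurableSet (s n) := fun n =>
    (measurableSet_le measurable_const hmeas).inter (measurableSet_lt hmeas measurable_const)
  have hfin : ∀ n, IsFiniteKernel (Kernel.piecewise (hs n) κ 0) := by
    intro n
    refine ⟨⟨n + 1, by finiteness, fun a => ?_⟩⟩
    rw [Kernel.piecewise_apply]
    split_ifs with ha
    · exact ha.2.le
    · simp
  have hsum : κ = Kernel.sum fun n => Kernel.piecewise (hs n) κ 0 := by
    ext a t ht
    rw [Kernel.sum_apply' _ _ ht]
    have hne := (h a).ne
    set m := ⌊(κ a univ).toReal⌋₊ with hm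
    have h1 : (m : ℝ≥0∞) ≤ κ a univ := by
      rw [← ENNReal.ofReal_toReal hne, ← ENNReal.ofReal_natCast]
      exact ENNReal.ofReal_le_ofReal (Nat.floor_le ENNReal.toReal_nonneg)
    have h2 : κ a univ < m + 1 := by
      rw [← ENNReal.ofReal_toReal hne]
      have : ((m : ℝ≥0∞) + 1) = ENNReal.ofReal ((m : ℝ) + 1) := by
        rw [ENNReal.ofReal_add (by positivity) zero_le_one]; simp
      rw [this, ENNReal.ofReal_lt_ofReal_iff (by positivity)]
      exact Nat.lt_floor_add_one _
    rw [tsum_eq_single m]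
    · rw [Kernel.piecewise_apply, if_pos (show a ∈ s m from ⟨h1, h2⟩)]
    · intro n hn
      rw [Kernel.piecewise_apply, if_neg]
      · simp
      · rintro ⟨h3, h4⟩
        apply hn
        have e1 : (n : ℝ≥0∞) < m + 1 := h3.trans_lt h2
        have e2 : (m : ℝ≥0∞) < n + 1 := h1.trans_lt h4
        norm_cast at e1 e2
        omega
  rw [hsum]
  exact Kernel.isSFiniteKernel_sum

/-- The total mass of the density `f(s) exp(-∫_r^s f)` on `(r, ∞)` is at most one. -/
theorem lintegral_exp_neg_mul_le_one {f : ℝ → ℝ≥0∞} (hf : Measurable f) {C : ℝ≥0}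
    (hC : ∀ s, f s ≤ C) (r : ℝ) :
    ∫⁻ s in Ioi r, ENNReal.ofReal (Real.exp (-(∫⁻ θ in Ioc r s, f θ).toReal)) * f s ≤ 1 := by
  have hfin : ∀ s, f s ≠ ∞ := fun s => ((hC s).trans_lt ENNReal.coe_lt_top).ne
  set g : ℝ → ℝ := fun s => (f s).toReal with hg
  have hgm : Measurable g := hf.ennreal_toReal
  have hg0 : ∀ s, 0 ≤ g s := fun s => ENNReal.toReal_nonneg
  have hgC : ∀ s, g s ≤ C := fun s => ENNReal.toReal_le_coe_of_le_coe (hC s)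
  have hint : ∀ a b, IntervalIntegrable g volume a b := fun a b =>
    (intervalIntegrable_const (c := (C : ℝ))).mono_fun hgm.aestronglyMeasurable
      (Eventually.of_forall fun s => by
        simpa [Real.norm_of_nonneg (hg0 s)] using hgC s)
  set F : ℝ → ℝ := fun s => ∫ θ in r..s, g θ with hF
  have hFeq : ∀ s, r ≤ s → (∫⁻ θ in Ioc r s, f θ).toReal = F s := by
    intro s hs
    simp only [hF, hg]
    rw [intervalIntegral.integral_of_le hs, integral_toReal hf.aemeasurable]
    exact Eventually.of_forall fun s => (hfin s).lt_top
  have hFnn : ∀ s, r ≤ s → 0 ≤ F s := fun s hs => by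
    rw [← hFeq s hs]; exact ENNReal.toReal_nonneg
  have hFlip : LipschitzWith C F := by
    refine LipschitzWith.of_dist_le_mul fun a b => ?_
    rw [Real.dist_eq, Real.dist_eq]
    have : F a - F b = ∫ θ in b..a, g θ := by
      simp only [hF]
      rw [intervalIntegral.integral_interval_sub_left (hint _ _) (hint _ _)]
    rw [this, ← Real.norm_eq_abs]
    exact intervalIntegral.norm_integral_le_of_norm_le_const fun s _ => by
      rw [Real.norm_of_nonneg (hg0 s)]; exact hgC s
  set G : ℝ → ℝ := fun s => Real.exp (-F s) with hG
  have hbound : ∀ b, r ≤ b → ∫⁻ s in Ioc r b, ENNReal.ofReal (G s) * f s ≤ 1 := by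
    intro b hb
    have hexp : LipschitzOnWith 1 (fun y : ℝ => Real.exp (-y)) (Ici 0) := by
      refine (convex_Ici (0 : ℝ)).lipschitzOnWith_of_nnnorm_deriv_le
        (fun y _ => by fun_prop) fun y hy => ?_
      have : deriv (fun y : ℝ => Real.exp (-y)) y = -Real.exp (-y) := by
        have := (hasDerivAt_neg y).exp.deriv
        simpa using this
      rw [this, ← NNReal.coe_le_coe, coe_nnnorm, norm_neg, Real.norm_of_nonneg (Real.exp_pos _).le]
      simpa using hy
    have hGlip : LipschitzOnWith (1 * C) G (uIcc r b) := by
      refine hexp.comp hFlip.lipschitzOnWith fun s hs => ?_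
      rw [uIcc_of_le hb] at hs
      exact hFnn s hs.1
    have hAC := hGlip.absolutelyContinuousOnInterval
    have hFTC := hAC.integral_deriv_eq_sub
    have hder : ∀ᵐ s, s ∈ uIoc r b → deriv G s = -(G s * g s) := by
      filter_upwards [(hint r b).ae_hasDerivAt_integral] with s hs hsm
      have h1 : HasDerivAt F (g s) s := hs (uIoc_subset_uIcc hsm) r left_mem_uIcc
      have h2 : HasDerivAt G (Real.exp (-F s) * -g s) s := h1.neg.exp
      rw [h2.deriv]
      simp [hG]
    rw [intervalIntegral.integral_congr_ae hder, intervalIntegral.integral_neg] at hFTC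
    have hGm : Measurable G := (Real.measurable_exp.comp hFlip.continuous.measurable.neg)
    have hle : ∀ s, ‖G s * g s‖ₑ = ENNReal.ofReal (G s) * f s := by
      intro s
      rw [Real.enorm_of_nonneg (mul_nonneg (Real.exp_pos _).le (hg0 s)),
        ENNReal.ofReal_mul (Real.exp_pos _).le, hg, ENNReal.ofReal_toReal (hfin s)]
    have hGint : IntervalIntegrable (fun s => G s * g s) volume r b :=
      (hint r b).continuousOn_mul
        (Real.continuous_exp.comp hFlip.continuous.neg).continuousOn
    have hGr : G r = 1 := by simp [hG, hF]
    have hval : ∫ s in r..b, G s * g s ≤ 1 := by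
      have := (Real.exp_pos (-F b)).le
      have h2 : G b = Real.exp (-F b) := rfl
      linarith
    rw [intervalIntegral.integral_of_le hb] at hval
    have h3 : ∫⁻ s in Ioc r b, ENNReal.ofReal (G s) * f s
        = ENNReal.ofReal (∫ s in Ioc r b, G s * g s) := by
      rw [ofReal_integral_eq_lintegral_ofReal hGint.1
        (Eventually.of_forall fun s => mul_nonneg (Real.exp_pos _).le (hg0 s))]
      refine lintegral_congr fun s => ?_
      rw [ENNReal.ofReal_mul (Real.exp_pos _).le, hg, ENNReal.ofReal_toReal (hfin s)]
    rw [h3]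
    exact ENNReal.ofReal_le_one.2 hval
  have hU : Ioi r = ⋃ n : ℕ, Ioc r (r + n) := by
    ext s
    simp only [mem_Ioi, mem_iUnion, mem_Ioc]
    constructor
    · intro hs
      obtain ⟨n, hn⟩ := exists_nat_ge (s - r)
      exact ⟨n, hs, by linarith⟩
    · rintro ⟨n, h, _⟩
      exact h
  have hmono : Monotone fun n : ℕ => Ioc r (r + n) := fun m n hmn =>
    Ioc_subset_Ioc_right (by gcongr)
  calc ∫⁻ s in Ioi r, ENNReal.ofReal (Real.exp (-(∫⁻ θ in Ioc r s, f θ).toReal)) * f s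
      = ∫⁻ s in Ioi r, ENNReal.ofReal (G s) * f s := by
        refine setLIntegral_congr_fun measurableSet_Ioi fun s hs => ?_
        simp only [hG, hFeq s (le_of_lt hs)]
    _ = ⨆ n : ℕ, ∫⁻ s in Ioc r (r + n), ENNReal.ofReal (G s) * f s := by
        rw [hU, setLIntegral_iUnion_of_directed _ hmono.directed_le]
    _ ≤ 1 := iSup_le fun n => hbound _ (by simp)

/-- A continuous-time Markov decision process with state space `S` and action space `A`. The set
`K` is the graph of the multifunction `x ↦ A(x)` of admissible actions, and `q` and `c` matter only
on `K`. -/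
structure CTMDP (S A : Type*) [MeasurableSpace S] [MeasurableSpace A] where
  /-- The admissible pairs: `A(x) = {a | (x, a) ∈ K}`. -/
  K : Set (S × A)
  measurableSet_K : MeasurableSet K
  exists_selector : ∃ φ : S → A, Measurable φ ∧ ∀ x, (x, φ x) ∈ K
  /-- The transition rates `q(dy|x,a)`, a signed kernel on `S` given `(x,a) ∈ K`. -/
  q : S × A → SignedMeasure S
  measurable_q : ∀ Γ, MeasurableSet Γ → Measurable fun k : K => q k Γ
  q_nonneg : ∀ x a, (x, a) ∈ K → ∀ Γ, MeasurableSet Γ → 0 ≤ q (x, a) (Γ \ {x})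
  conservative : ∀ x a, (x, a) ∈ K → q (x, a) univ = 0
  stable : ∀ x, BddAbove {r : ℝ | ∃ a, (x, a) ∈ K ∧ r = -q (x, a) {x}}
  /-- The cost rate. -/
  c : S × A → ℝ≥0
  measurable_c : Measurable fun k : K => c k

namespace CTMDP

variable {S A : Type*} [MeasurableSpace S] [MeasurableSpace A]

/-- A Markov policy `π(da|x,t)`: a stochastic kernel concentrated on `A(x)`. Only its values at
times `t > 0` matter. -/
structure MarkovPolicy (M : CTMDP S A) where
  kernel : Kernel (S × ℝ) A
  isMarkovKernel : IsMarkovKernel kernel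
  concentrated : ∀ x t, kernel (x, t) {a | (x, a) ∉ M.K} = 0

/-- A (randomized) stationary policy `π(da|x)`. -/
structure StationaryPolicy (M : CTMDP S A) where
  kernel : Kernel S A
  isMarkovKernel : IsMarkovKernel kernel
  concentrated : ∀ x, kernel x {a | (x, a) ∉ M.K} = 0

/-- A stationary policy, seen as a Markov policy. -/
noncomputable def StationaryPolicy.toMarkov {M : CTMDP S A} (π : M.StationaryPolicy) :
    M.MarkovPolicy where
  kernel := π.kernel.comap Prod.fst measurable_fst
  isMarkovKernel := by
    have := π.isMarkovKernel
    infer_instance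
  concentrated x t := by simpa using π.concentrated x

attribute [instance] MarkovPolicy.isMarkovKernel StationaryPolicy.isMarkovKernel

variable (M : CTMDP S A)

/-- The total jump rate `q_x(a) = -q({x}|x,a)`. -/
noncomputable def rate (x : S) (a : A) : ℝ≥0∞ := ENNReal.ofReal (-M.q (x, a) {x})

theorem zero_le_restrict_compl [MeasurableSingletonClass S] {k : S × A} (hk : k ∈ M.K) :
    VectorMeasure.restrict 0 {k.1}ᶜ ≤ VectorMeasure.restrict (M.q k) {k.1}ᶜ := by
  refine VectorMeasure.restrict_le_restrict_of_subset_le _ _ fun Γ hΓ hsub => ?_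
  have h := M.q_nonneg k.1 k.2 hk Γ hΓ
  rwa [sdiff_singleton_eq_self (fun hx => hsub hx rfl)] at h

open Classical in
/-- The measure `Γ ↦ q(Γ ∖ {x}|x,a)` for `(x,a) ∈ K`. -/
noncomputable def offDiagMeasure [MeasurableSingletonClass S] (k : S × A) : Measure S :=
  if hk : k ∈ M.K then
    (M.q k).toMeasureOfZeroLE {k.1}ᶜ (measurableSet_singleton _).compl
      (M.zero_le_restrict_compl hk)
  else 0

theorem offDiagMeasure_apply [MeasurableSingletonClass S] {k : S × A} (hk : k ∈ M.K)
    {Γ : Set S} (hΓ : MeasurableSet Γ) :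
    M.offDiagMeasure k Γ = ENNReal.ofReal (M.q k (Γ \ {k.1})) := by
  have h := M.q_nonneg k.1 k.2 hk Γ hΓ
  rw [offDiagMeasure, dif_pos hk, SignedMeasure.toMeasureOfZeroLE_apply _ _ _ hΓ,
    ENNReal.ofReal, ENNReal.coe_inj]
  apply NNReal.eq
  rw [Real.coe_toNNReal _ h]
  change M.q k ({k.1}ᶜ ∩ Γ) = M.q k (Γ \ {k.1})
  rw [sdiff_eq, inter_comm]

theorem measurable_q_section {D : Set (M.K × S)} (hD : MeasurableSet D) :
    Measurable fun k : M.K => M.q k (Prod.mk k ⁻¹' D) := by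
  induction D, hD using MeasurableSpace.induction_on_inter generateFrom_prod.symm isPiSystem_prod
    with
  | empty => simp
  | basic t ht =>
    classical
    obtain ⟨s, hs, Γ, hΓ, rfl⟩ := ht
    have : (fun k : M.K => M.q k (Prod.mk k ⁻¹' (s ×ˢ Γ)))
        = s.indicator (fun k : M.K => M.q k Γ) := by
      ext k
      by_cases hk : k ∈ s
      · simp [hk]
      · simp [hk]
    rw [this]
    exact (M.measurable_q Γ hΓ).indicator hs
  | compl t ht ih =>
    have : (fun k : M.K => M.q k (Prod.mk k ⁻¹' tᶜ))
        = fun k : M.K => M.q k univ - M.q k (Prod.mk k ⁻¹' t) := by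
      ext k
      have h := VectorMeasure.of_add_of_sdiff (v := M.q k)
        (measurable_prodMk_left ht : MeasurableSet (Prod.mk k ⁻¹' t)) MeasurableSet.univ (subset_univ _)
      rw [preimage_compl, compl_eq_univ_sdiff, ← h]
      ring
    rw [this]
    exact (M.measurable_q _ MeasurableSet.univ).sub ih
  | iUnion f hd hf ih =>
    have : ∀ k : M.K, HasSum (fun n => M.q k (Prod.mk k ⁻¹' f n))
        (M.q k (Prod.mk k ⁻¹' ⋃ n, f n)) := by
      intro k
      rw [preimage_iUnion]
      exact (M.q k).m_iUnion (fun n => measurable_prodMk_left (hf n))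
        fun i j hij => (hd hij).preimage _
    have h2 : (fun k : M.K => M.q k (Prod.mk k ⁻¹' ⋃ n, f n))
        = fun k : M.K => ∑' n, M.q k (Prod.mk k ⁻¹' f n) := by
      ext k; exact (this k).tsum_eq.symm
    refine measurable_of_tendsto_metrizable
      (f := fun (N : ℕ) (k : M.K) => ∑ n ∈ Finset.range N, M.q k (Prod.mk k ⁻¹' f n))
      (fun N => Finset.measurable_fun_sum _ fun n _ => ih n) ?_
    exact tendsto_pi_nhds.2 fun k => (this k).tendsto_sum_nat

set_option linter.unusedSectionVars false

variable [StandardBorelSpace S]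

theorem measurable_offDiagMeasure : Measurable M.offDiagMeasure := by
  classical
  refine Measure.measurable_of_measurable_coe _ fun Γ hΓ => ?_
  refine measurable_of_restrict_of_restrict_compl M.measurableSet_K ?_ ?_
  · have hD : MeasurableSet {p : M.K × S | p.2 ∈ Γ \ {p.1.1.1}} := by
      refine (measurable_snd hΓ).diff ?_
      exact measurableSet_eq_fun measurable_snd
        (measurable_fst.comp (measurable_subtype_coe.comp measurable_fst))
    have := (M.measurable_q_section hD).ennreal_ofReal
    convert this using 2 with k
    exact M.offDiagMeasure_apply k.2 hΓ
  · convert (measurable_const : Measurable fun _ : ↥M.Kᶜ => (0 : ℝ≥0∞)) using 2 with k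
    have hk : (k : S × A) ∉ M.K := k.2
    simp [offDiagMeasure, hk]

/-- The kernel `(x,a) ↦ q(dy ∖ {x}|x,a)`. -/
noncomputable def offDiag : Kernel (S × A) S := ⟨M.offDiagMeasure, M.measurable_offDiagMeasure⟩

variable {M}
variable (π : M.MarkovPolicy)

/-- `∫ c(x,a) π(da|x,s)`. -/
noncomputable def meanCost (x : S) (s : ℝ) : ℝ≥0∞ := ∫⁻ a, M.c (x, a) ∂π.kernel (x, s)

/-- `∫ q_x(a) π(da|x,s)`. -/
noncomputable def meanRate (x : S) (s : ℝ) : ℝ≥0∞ := ∫⁻ a, M.rate x a ∂π.kernel (x, s)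

/-- The kernel `Γ ↦ ∫ q(Γ ∖ {x}|x,a) π(da|x,s)`. -/
noncomputable def jumpRate : Kernel (S × ℝ) S :=
  M.offDiag ∘ₖ (Kernel.deterministic Prod.fst measurable_fst ×ₖ π.kernel)

/-- `exp(-∫_u^s ∫ q_x(a) π(da|x,θ) dθ)`. -/
noncomputable def survival (x : S) (u s : ℝ) : ℝ≥0∞ :=
  ENNReal.ofReal (Real.exp (-(∫⁻ θ in Ioc u s, meanRate π x θ).toReal))

theorem jumpRate_apply (x : S) (s : ℝ) {Γ : Set S} (hΓ : MeasurableSet Γ) :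
    jumpRate π (x, s) Γ = ∫⁻ a, M.offDiagMeasure (x, a) Γ ∂π.kernel (x, s) := by
  rw [jumpRate, Kernel.comp_apply' _ _ _ hΓ, Kernel.lintegral_prod _ _ _ (M.offDiag.measurable_coe hΓ),
    Kernel.lintegral_deterministic']
  · rfl
  · exact (M.offDiag.measurable_coe hΓ).lintegral_prod_right'

theorem ae_mem_K (x : S) (s : ℝ) : ∀ᵐ a ∂π.kernel (x, s), (x, a) ∈ M.K :=
  ae_iff.2 (π.concentrated x s)

theorem offDiagMeasure_univ {x : S} {a : A} (h : (x, a) ∈ M.K) :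
    M.offDiagMeasure (x, a) univ = M.rate x a := by
  rw [M.offDiagMeasure_apply h MeasurableSet.univ, rate]
  congr 1
  have h2 := VectorMeasure.of_add_of_sdiff (v := M.q (x, a)) (measurableSet_singleton x)
        MeasurableSet.univ (subset_univ _)
  rw [M.conservative x a h] at h2
  linarith

theorem jumpRate_univ (x : S) (s : ℝ) : jumpRate π (x, s) univ = meanRate π x s := by
  rw [jumpRate_apply π x s MeasurableSet.univ, meanRate]
  refine lintegral_congr_ae ?_
  filter_upwards [ae_mem_K π x s] with a ha
  exact offDiagMeasure_univ ha

theorem exists_meanRate_le (x : S) : ∃ C : ℝ≥0, ∀ s, meanRate π x s ≤ C := by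
  obtain ⟨b, hb⟩ := M.stable x
  refine ⟨b.toNNReal, fun s => ?_⟩
  calc meanRate π x s ≤ ∫⁻ _, ENNReal.ofReal b ∂π.kernel (x, s) := by
        refine lintegral_mono_ae ?_
        filter_upwards [ae_mem_K π x s] with a ha
        exact ENNReal.ofReal_le_ofReal (hb ⟨a, ha, rfl⟩)
    _ = b.toNNReal := by simp [ENNReal.ofReal]

theorem measurable_meanRate : Measurable fun p : S × ℝ => meanRate π p.1 p.2 := by
  have := (jumpRate π).measurable_coe MeasurableSet.univ
  convert this using 2 with p
  exact (jumpRate_univ π p.1 p.2).symm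

instance isSFiniteKernel_jumpRate : IsSFiniteKernel (jumpRate π) := by
  refine isSFiniteKernel_of_forall_lt_top _ fun p => ?_
  obtain ⟨C, hC⟩ := exists_meanRate_le π p.1
  exact (jumpRate_univ π p.1 p.2).trans_le (hC p.2) |>.trans_lt ENNReal.coe_lt_top

/-- `1{r < s} exp(-∫_r^s ∫ q_x(a) π(da|x,θ) dθ)` for `z = (r, x)`. -/
noncomputable def aliveDensity (z : ℝ × S) (s : ℝ) : ℝ≥0 :=
  ((Ioi z.1).indicator (fun s => survival π z.2 z.1 s) s).toNNReal

theorem coe_aliveDensity (z : ℝ × S) (s : ℝ) :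
    (aliveDensity π z s : ℝ≥0∞) = (Ioi z.1).indicator (fun s => survival π z.2 z.1 s) s := by
  rw [aliveDensity, ENNReal.coe_toNNReal]
  by_cases h : s ∈ Ioi z.1
  · rw [indicator_of_mem h, survival]; exact ENNReal.ofReal_ne_top
  · rw [indicator_of_notMem h]; exact ENNReal.zero_ne_top

theorem measurable_survival :
    Measurable fun p : (ℝ × S) × ℝ => survival π p.1.2 p.1.1 p.2 := by
  have h : Measurable fun p : (ℝ × S) × ℝ => ∫⁻ θ in Ioc p.1.1 p.2, meanRate π p.1.2 θ := by
    have h1 : (fun p : (ℝ × S) × ℝ => ∫⁻ θ in Ioc p.1.1 p.2, meanRate π p.1.2 θ)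
        = fun p => ∫⁻ θ, {y : ((ℝ × S) × ℝ) × ℝ | y.1.1.1 < y.2 ∧ y.2 ≤ y.1.2}.indicator
            (fun y => meanRate π y.1.1.2 y.2) (p, θ) := by
      ext p
      rw [← lintegral_indicator measurableSet_Ioc]
      rfl
    rw [h1]
    refine Measurable.lintegral_prod_right' (Measurable.indicator ?_ ?_)
    · exact (measurable_meanRate π).comp (f := fun y : ((ℝ × S) × ℝ) × ℝ => (y.1.1.2, y.2))
        (by fun_prop)
    · exact (measurableSet_lt (f := fun y : ((ℝ × S) × ℝ) × ℝ => y.1.1.1) (g := fun y => y.2)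
        (by fun_prop) (by fun_prop)).inter
        (measurableSet_le (f := fun y : ((ℝ × S) × ℝ) × ℝ => y.2) (g := fun y => y.1.2)
        (by fun_prop) (by fun_prop))
  exact (Real.measurable_exp.comp h.ennreal_toReal.neg).ennreal_ofReal

theorem measurable_aliveDensity :
    Measurable (Function.uncurry fun z s => (aliveDensity π z s : ℝ≥0∞)) := by
  simp only [coe_aliveDensity]
  exact Measurable.indicator (s := {p : (ℝ × S) × ℝ | p.1.1 < p.2}) (measurable_survival π)
    (measurableSet_lt (by fun_prop) (by fun_prop))

/-- The sub-probability kernel of the next jump: given a jump at time `r` into the state `x`, the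
next jump happens at `ds` and leads into `dy` with probability
`1{r < s} exp(-∫_r^s ∫ q_x(a) π(da|x,θ) dθ) ∫ q(dy ∖ {x}|x,a) π(da|x,s) ds`. -/
noncomputable def jumpKernel : Kernel (ℝ × S) (ℝ × S) :=
  (Kernel.const (ℝ × S) (volume : Measure ℝ)).withDensity (fun z s => aliveDensity π z s) ⊗ₖ
    (jumpRate π).comap (fun p : (ℝ × S) × ℝ => (p.1.2, p.2)) (by fun_prop)

theorem lintegral_jumpKernel (z : ℝ × S) {f : ℝ × S → ℝ≥0∞} (hf : Measurable f) :
    ∫⁻ w, f w ∂jumpKernel π z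
      = ∫⁻ s in Ioi z.1, survival π z.2 z.1 s * ∫⁻ y, f (s, y) ∂jumpRate π (z.2, s) := by
  rw [jumpKernel, Kernel.lintegral_compProd _ _ _ hf,
    Kernel.lintegral_withDensity _ (measurable_aliveDensity π)]
  · rw [Kernel.const_apply, ← lintegral_indicator measurableSet_Ioi]
    refine lintegral_congr fun s => ?_
    rw [coe_aliveDensity]
    by_cases h : s ∈ Ioi z.1
    · rw [indicator_of_mem h, indicator_of_mem h, Kernel.comap_apply]
    · rw [indicator_of_notMem h, indicator_of_notMem h, zero_mul]
  · exact Measurable.lintegral_kernel_prod_right'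
      (κ := (jumpRate π).comap (fun p : (ℝ × S) × ℝ => (p.1.2, p.2)) (by fun_prop))
      (f := fun q : ((ℝ × S) × ℝ) × S => f (q.1.2, q.2)) (by fun_prop) |>.comp
      measurable_prodMk_left

theorem jumpKernel_univ_le (z : ℝ × S) : jumpKernel π z univ ≤ 1 := by
  obtain ⟨C, hC⟩ := exists_meanRate_le π z.2
  have h := lintegral_jumpKernel π z (f := fun _ => 1) measurable_const
  simp only [lintegral_one, jumpRate_univ] at h
  rw [h]
  exact lintegral_exp_neg_mul_le_one
    ((measurable_meanRate π).comp (measurable_prodMk_left (x := z.2))) hC z.1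

/-- The outcome of one step of the marked point process: `inl (t_n, x_n)` for a jump at the moment
`t_n` into the state `x_n`, and `inr ()` for `(t_n, x_n) = (∞, x_∞)`. -/
abbrev Mark (S : Type*) := (ℝ × S) ⊕ Unit

/-- The conditional law of `(t_{n+1}, x_{n+1})` given `(t_n, x_n)`. -/
noncomputable def nextMark : Kernel (Mark S) (Mark S) where
  toFun := Sum.elim
    (fun z => (jumpKernel π z).map Sum.inl
      + (1 - jumpKernel π z univ) • Measure.dirac (Sum.inr ()))
    (fun _ => Measure.dirac (Sum.inr ()))
  measurable' := by
    refine Measurable.sumElim ?_ measurable_const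
    refine Measure.measurable_of_measurable_coe _ fun Γ hΓ => ?_
    simp only [Measure.add_apply, Measure.smul_apply, smul_eq_mul,
      Measure.map_apply measurable_inl hΓ]
    exact ((jumpKernel π).measurable_coe (measurable_inl hΓ)).add
      ((measurable_const.sub ((jumpKernel π).measurable_coe MeasurableSet.univ)).mul_const _)

instance isMarkovKernel_nextMark : IsMarkovKernel (nextMark π) := by
  refine ⟨fun m => ⟨?_⟩⟩
  rcases m with z | u
  · change ((jumpKernel π z).map Sum.inl
      + (1 - jumpKernel π z univ) • Measure.dirac (Sum.inr ()) : Measure (Mark S)) univ = 1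
    rw [Measure.add_apply, Measure.map_apply measurable_inl MeasurableSet.univ, preimage_univ,
      Measure.smul_apply, smul_eq_mul, measure_univ (μ := Measure.dirac (Sum.inr ())), mul_one]
    exact add_tsub_cancel_of_le (jumpKernel_univ_le π z)
  · change (Measure.dirac (Sum.inr ()) : Measure (Mark S)) univ = 1
    exact measure_univ

/-- The law `P_γ^π` of the sequence `(t_n, x_n)`, with `t_0 = 0` and `x_0` distributed according
to `γ`. -/
noncomputable def law (γ : Measure S) : Measure (ℕ → Mark S) :=
  Kernel.trajMeasure (X := fun _ => Mark S) (γ.map fun x => Sum.inl (0, x))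
    (fun n => (nextMark π).comap (fun h => h ⟨n, Finset.mem_Iic.2 le_rfl⟩) (measurable_pi_apply _))

/-- The jump moment of a mark, in `(-∞, ∞]`. -/
noncomputable def jumpTime : Mark S → EReal := Sum.elim (fun z => (z.1 : EReal)) fun _ => ⊤

open Classical in
/-- The jump process: `ξ_t = x_n` for `t_n ≤ t < t_{n+1}`, and `ξ_t = x_∞`, that is, `inr ()`, if
there is no such `n`. -/
noncomputable def process (t : ℝ) (ω : ℕ → Mark S) : S ⊕ Unit :=
  if h : ∃ n, jumpTime (ω n) ≤ t ∧ (t : EReal) < jumpTime (ω (n + 1)) then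
    Sum.map Prod.snd id (ω (Nat.find h))
  else Sum.inr ()

theorem measurable_process (t : ℝ) : Measurable (process (S := S) t) := by
  classical
  have hj : Measurable (jumpTime (S := S)) :=
    Measurable.sumElim (measurable_coe_real_ereal.comp measurable_fst) measurable_const
  have hp : ∀ n, MeasurableSet {ω : ℕ → Mark S |
      jumpTime (ω n) ≤ t ∧ (t : EReal) < jumpTime (ω (n + 1))} := fun n =>
    (measurableSet_le (hj.comp (measurable_pi_apply n)) measurable_const).inter
      (measurableSet_lt measurable_const (hj.comp (measurable_pi_apply (n + 1))))
  have hE : MeasurableSet {ω : ℕ → Mark S |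
      ∃ n, jumpTime (ω n) ≤ t ∧ (t : EReal) < jumpTime (ω (n + 1))} := by
    rw [ofPred_exists]
    exact MeasurableSet.iUnion hp
  refine measurable_of_restrict_of_restrict_compl hE ?_ ?_
  · have h := Measurable.find
      (f := fun n (ω : {ω : ℕ → Mark S |
        ∃ n, jumpTime (ω n) ≤ t ∧ (t : EReal) < jumpTime (ω (n + 1))}) =>
          (Sum.map Prod.snd id (ω.1 n) : S ⊕ Unit))
      (p := fun n ω => jumpTime (ω.1 n) ≤ t ∧ (t : EReal) < jumpTime (ω.1 (n + 1)))
      (fun n => (Measurable.sumMap measurable_snd measurable_id).comp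
        ((measurable_pi_apply n).comp measurable_subtype_coe))
      (fun n => measurable_subtype_coe (hp n)) (fun ω => ω.2)
    convert h using 2 with ω
    exact dif_pos (show ∃ n, _ from ω.2)
  · convert (measurable_const : Measurable fun _ => (Sum.inr () : S ⊕ Unit)) using 2 with ω
    exact dif_neg (show ¬ ∃ n, _ from ω.2)

/-- The transition function `p^π(u,x,t,dy) = P_x^π(ξ_t ∈ dy | ξ_u = x)` on `S`. The state `x` is
an atom of the law of `ξ_u` under `P_x^π`, since the jump rates out of `x` are bounded. -/
noncomputable def transition (u : ℝ) (x : S) (t : ℝ) : Measure S :=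
  ((cond (law π (Measure.dirac x)) (process u ⁻¹' {Sum.inl x})).map (process t)).comap Sum.inl

/-- The family `p` of sub-probability kernels satisfies `P_γ^π(ξ_t ∈ dy | ξ_u) = p(u,ξ_u,t,dy)`
on `{ξ_u ∈ S}`, `P_γ^π`-almost surely, for all initial distributions `γ` and all `0 ≤ u ≤ t`. -/
def IsTransitionFunction (p : ℝ → S → ℝ → Measure S) : Prop :=
  ∀ u t, 0 ≤ u → u ≤ t →
    (∀ x, p u x t univ ≤ 1) ∧
    (∀ Γ, MeasurableSet Γ → Measurable fun x => p u x t Γ) ∧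
    ∀ γ : Measure S, IsProbabilityMeasure γ → ∀ B Γ : Set S, MeasurableSet B → MeasurableSet Γ →
      law π γ {ω | process u ω ∈ Sum.inl '' B ∧ process t ω ∈ Sum.inl '' Γ}
        = ∫⁻ y in B, p u y t Γ ∂((law π γ).map (process u)).comap Sum.inl

/-- `W^π(u,x,t) = ∫_u^t ∫_S ∫_A c(y,a) π(da|y,s) p^π(u,x,s,dy) ds`. -/
noncomputable def expectedCost (u : ℝ) (x : S) (t : ℝ) : ℝ≥0∞ :=
  ∫⁻ s in Ioc u t, ∫⁻ y, meanCost π y s ∂transition π u x s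

/-- The right-hand side of the integral inequality. -/
noncomputable def costOperator (v : ℝ → S → ℝ → ℝ≥0∞) (u : ℝ) (x : S) (t : ℝ) : ℝ≥0∞ :=
  (∫⁻ θ in Ioc u t, meanCost π x θ) * survival π x u t
    + ∫⁻ s in Ioc u t, survival π x u s *
        (meanRate π x s * (∫⁻ θ in Ioc u s, meanCost π x θ)
          + ∫⁻ y, v s y t ∂jumpRate π (x, s))

/-- A nonnegative measurable solution of the inequality `v(u,x,t) ≥ costOperator v u x t`,
`0 ≤ u ≤ t`, `x ∈ S`. -/
def IsSolution (v : ℝ → S → ℝ → ℝ≥0∞) : Prop :=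
  Measurable (fun p : ℝ × S × ℝ => v p.1 p.2.1 p.2.2) ∧
    ∀ u x t, 0 ≤ u → u ≤ t → costOperator π v u x t ≤ v u x t

/-- The long-run average cost
`W(x,π) = limsup_{T → ∞} (1/T) E_x^π [∫_0^T ∫_A c(ξ_t,a) π(da|ξ_t,t) dt]`, where the cost in the
cemetery is zero. -/
noncomputable def averageCost (x : S) : ℝ≥0∞ :=
  limsup (fun T : ℝ =>
    (∫⁻ ω, (∫⁻ t in Ioc 0 T, Sum.elim (fun y => meanCost π y t) (fun _ => 0) (process t ω))
      ∂law π (Measure.dirac x)) / ENNReal.ofReal T) atTop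

end CTMDP

/-! Everything is expressed through the occupation kernel of the jump chain, the sum over n of the
laws of (t_n, x_n) on {t_n < ∞}, started from an arbitrary pair (r, x). Almost every path has
monotone jump times, so t lies in at most one sojourn. The expectation of f(ξ_t), with f = 0 in the
cemetery, is thus a sum over sojourns. Integrating out the jump that ends each sojourn leaves the
integral of f(y) exp(-∫_r^t q_y) against the occupation kernel from (0, x_0)
(`lintegral_law_process`).

The Markov property at a fixed time u comes from the lack of memory of the holding times. If x was
entered at r and has not been left by u, the next jump is distributed as if x had been entered at u
(`lintegral_nextMark_late_mul`). Hence the future after u is described by the occupation kernel from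
(u, ξ_u) (`lintegral_law_process_mul_process`). Conditioning on {ξ_u = x}, an event of positive
probability under P_x, identifies this description with `transition` (`transition_apply`).

By Tonelli, W^π(u,x,t) is the integral of the expected cost of one sojourn against the occupation
kernel from (u, x) (`expectedCost_eq`). Integration by parts shows that the right-hand side of the
inequality is the cost of the first sojourn plus the integral of v over the first jump, if it occurs
by t. So W^π satisfies the inequality with equality, by decomposition at the first jump. Any other
solution dominates W^π, since iterating the inequality bounds it below by every partial sum of the
series over jumps (`expectedCost_le_of_isSolution`).

For (b), v(u,x,t) = g(t-u) + h(x) solves the integral inequality. Minimality bounds the expected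
cost on (0, T] by gT + h(x), and division by T removes h(x) in the limit. -/

/-- The density `f(s) exp(-∫_r^s f)` integrates over `(r, b]` to `1 - exp(-∫_r^b f)`. -/
theorem lintegral_exp_neg_mul_add_exp_neg {f : ℝ → ℝ≥0∞} (hf : Measurable f) {C : ℝ≥0}
    (hC : ∀ s, f s ≤ C) {r b : ℝ} (hb : r ≤ b) :
    (∫⁻ s in Ioc r b, ENNReal.ofReal (Real.exp (-(∫⁻ θ in Ioc r s, f θ).toReal)) * f s)
      + ENNReal.ofReal (Real.exp (-(∫⁻ θ in Ioc r b, f θ).toReal)) = 1 := by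
  have hfin : ∀ s, f s ≠ ∞ := fun s => ((hC s).trans_lt ENNReal.coe_lt_top).ne
  set g : ℝ → ℝ := fun s => (f s).toReal with hg
  have hgm : Measurable g := hf.ennreal_toReal
  have hg0 : ∀ s, 0 ≤ g s := fun s => ENNReal.toReal_nonneg
  have hgC : ∀ s, g s ≤ C := fun s => ENNReal.toReal_le_coe_of_le_coe (hC s)
  have hint : ∀ a b, IntervalIntegrable g volume a b := fun a b =>
    (intervalIntegrable_const (c := (C : ℝ))).mono_fun hgm.aestronglyMeasurable
      (Eventually.of_forall fun s => by
        simpa [Real.norm_of_nonneg (hg0 s)] using hgC s)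
  set F : ℝ → ℝ := fun s => ∫ θ in r..s, g θ with hF
  have hFeq : ∀ s, r ≤ s → (∫⁻ θ in Ioc r s, f θ).toReal = F s := by
    intro s hs
    simp only [hF, hg]
    rw [intervalIntegral.integral_of_le hs, integral_toReal hf.aemeasurable]
    exact Eventually.of_forall fun s => (hfin s).lt_top
  have hFnn : ∀ s, r ≤ s → 0 ≤ F s := fun s hs => by
    rw [← hFeq s hs]; exact ENNReal.toReal_nonneg
  -- The rate is merely measurable, so the classical fundamental theorem is not available.
  -- Boundedness by `C` makes the primitive Lipschitz, hence exp(-F) absolutely continuous, and an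
  -- almost everywhere derivative suffices.
  have hFlip : LipschitzWith C F := by
    refine LipschitzWith.of_dist_le_mul fun a b => ?_
    rw [Real.dist_eq, Real.dist_eq]
    have : F a - F b = ∫ θ in b..a, g θ := by
      simp only [hF]
      rw [intervalIntegral.integral_interval_sub_left (hint _ _) (hint _ _)]
    rw [this, ← Real.norm_eq_abs]
    exact intervalIntegral.norm_integral_le_of_norm_le_const fun s _ => by
      rw [Real.norm_of_nonneg (hg0 s)]; exact hgC s
  set G : ℝ → ℝ := fun s => Real.exp (-F s) with hG
  -- The map y ↦ exp(-y) is Lipschitz only on a half-line bounded below; `F` is nonnegative to the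
  -- right of `r`.
  have hexp : LipschitzOnWith 1 (fun y : ℝ => Real.exp (-y)) (Ici 0) := by
    refine (convex_Ici (0 : ℝ)).lipschitzOnWith_of_nnnorm_deriv_le
      (fun y _ => by fun_prop) fun y hy => ?_
    have : deriv (fun y : ℝ => Real.exp (-y)) y = -Real.exp (-y) := by
      have := (hasDerivAt_neg y).exp.deriv
      simpa using this
    rw [this, ← NNReal.coe_le_coe, coe_nnnorm, norm_neg, Real.norm_of_nonneg (Real.exp_pos _).le]
    simpa using hy
  have hGlip : LipschitzOnWith (1 * C) G (uIcc r b) := by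
    refine hexp.comp hFlip.lipschitzOnWith fun s hs => ?_
    rw [uIcc_of_le hb] at hs
    exact hFnn s hs.1
  have hFTC := hGlip.absolutelyContinuousOnInterval.integral_deriv_eq_sub
  have hder : ∀ᵐ s, s ∈ uIoc r b → deriv G s = -(G s * g s) := by
    filter_upwards [(hint r b).ae_hasDerivAt_integral] with s hs hsm
    have h1 : HasDerivAt F (g s) s := hs (uIoc_subset_uIcc hsm) r left_mem_uIcc
    have h2 : HasDerivAt G (Real.exp (-F s) * -g s) s := h1.neg.exp
    rw [h2.deriv]
    simp [hG]
  rw [intervalIntegral.integral_congr_ae hder, intervalIntegral.integral_neg] at hFTC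
  have hGint : IntervalIntegrable (fun s => G s * g s) volume r b :=
    (hint r b).continuousOn_mul
      (Real.continuous_exp.comp hFlip.continuous.neg).continuousOn
  have hGr : G r = 1 := by simp [hG, hF]
  have hval : ∫ s in r..b, G s * g s = 1 - G b := by linarith
  have h3 : ∫⁻ s in Ioc r b, ENNReal.ofReal (Real.exp (-(∫⁻ θ in Ioc r s, f θ).toReal)) * f s
      = ENNReal.ofReal (∫ s in Ioc r b, G s * g s) := by
    rw [ofReal_integral_eq_lintegral_ofReal hGint.1
      (Eventually.of_forall fun s => mul_nonneg (Real.exp_pos _).le (hg0 s))]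
    refine setLIntegral_congr_fun measurableSet_Ioc fun s hs => ?_
    simp only [hG, hFeq s hs.1.le]
    rw [ENNReal.ofReal_mul (Real.exp_pos _).le, hg, ENNReal.ofReal_toReal (hfin s)]
  have hG1 : G b ≤ 1 := Real.exp_le_one_iff.2 (neg_nonpos.2 (hFnn b hb))
  rw [h3, hFeq b hb, ← intervalIntegral.integral_of_le hb, hval,
    ← ENNReal.ofReal_add (sub_nonneg.2 hG1) (Real.exp_pos _).le]
  simp [hG]

namespace CTMDP

set_option linter.unusedSectionVars false

variable {S A : Type*} [MeasurableSpace S] [MeasurableSpace A] [StandardBorelSpace S]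
  {M : CTMDP S A} (π : M.MarkovPolicy)

/-! ### Survival probabilities and integration by parts. -/

section Survival

theorem measurable_meanRate_right (x : S) : Measurable fun s => meanRate π x s :=
  (measurable_meanRate π).comp (measurable_prodMk_left (x := x))

theorem measurable_survival_right (x : S) (u : ℝ) : Measurable fun s => survival π x u s :=
  (measurable_survival π).comp (f := fun s => ((u, x), s)) (by fun_prop)

/-- The cost is measurable only on `K`. Since the policy charges only admissible actions, extending
the cost by zero off `K` does not change its mean. -/
theorem measurable_meanCost : Measurable fun p : S × ℝ => meanCost π p.1 p.2 := by
  classical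
  have hc : Measurable fun k : S × A => M.K.indicator (fun k => (M.c k : ℝ≥0∞)) k := by
    refine measurable_of_restrict_of_restrict_compl M.measurableSet_K ?_ ?_
    · convert M.measurable_c.coe_nnreal_ennreal using 2 with k
      exact indicator_of_mem k.2 fun k => (M.c k : ℝ≥0∞)
    · convert (measurable_const : Measurable fun _ : ↥M.Kᶜ => (0 : ℝ≥0∞)) using 2 with k
      exact indicator_of_notMem (show (k : S × A) ∉ M.K from k.2) fun k => (M.c k : ℝ≥0∞)
  have h : (fun p : S × ℝ => meanCost π p.1 p.2)
      = fun p => ∫⁻ a, M.K.indicator (fun k => (M.c k : ℝ≥0∞)) (p.1, a) ∂π.kernel p := by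
    ext p
    refine lintegral_congr_ae ?_
    filter_upwards [ae_mem_K π p.1 p.2] with a ha
    rw [indicator_of_mem ha]
  rw [h]
  exact Measurable.lintegral_kernel_prod_right'
    (f := fun q : (S × ℝ) × A => M.K.indicator (fun k => (M.c k : ℝ≥0∞)) (q.1.1, q.2))
    (hc.comp (by fun_prop))

theorem measurable_meanCost_right (x : S) : Measurable fun s => meanCost π x s :=
  (measurable_meanCost π).comp (measurable_prodMk_left (x := x))

theorem lintegral_meanRate_ne_top (x : S) (u t : ℝ) :
    ∫⁻ θ in Ioc u t, meanRate π x θ ≠ ∞ := by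
  obtain ⟨C, hC⟩ := exists_meanRate_le π x
  refine ne_top_of_le_ne_top ?_ (lintegral_mono hC)
  simpa using ENNReal.mul_ne_top ENNReal.coe_ne_top ENNReal.ofReal_ne_top

theorem survival_ne_top (x : S) (u t : ℝ) : survival π x u t ≠ ∞ := ENNReal.ofReal_ne_top

theorem survival_pos (x : S) (u t : ℝ) : 0 < survival π x u t :=
  ENNReal.ofReal_pos.2 (Real.exp_pos _)

theorem survival_mul (x : S) {r u t : ℝ} (h1 : r ≤ u) (h2 : u ≤ t) :
    survival π x r u * survival π x u t = survival π x r t := by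
  rw [survival, survival, survival, ← ENNReal.ofReal_mul (Real.exp_pos _).le, ← Real.exp_add,
    ← Ioc_union_Ioc_eq_Ioc h1 h2, lintegral_union measurableSet_Ioc
      (Ioc_disjoint_Ioc_of_le le_rfl),
    ENNReal.toReal_add (lintegral_meanRate_ne_top π _ _ _) (lintegral_meanRate_ne_top π _ _ _),
    neg_add]

theorem lintegral_survival_mul_meanRate_add (x : S) {u t : ℝ} (h : u ≤ t) :
    (∫⁻ s in Ioc u t, survival π x u s * meanRate π x s) + survival π x u t = 1 := by
  obtain ⟨C, hC⟩ := exists_meanRate_le π x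
  exact lintegral_exp_neg_mul_add_exp_neg (measurable_meanRate_right π x) hC h

theorem lintegral_survival_mul_meanRate_add' (x : S) {u θ t : ℝ} (h1 : u ≤ θ) (h2 : θ ≤ t) :
    (∫⁻ s in Ioc θ t, survival π x u s * meanRate π x s) + survival π x u t
      = survival π x u θ := by
  have h : ∫⁻ s in Ioc θ t, survival π x u s * meanRate π x s
      = survival π x u θ * ∫⁻ s in Ioc θ t, survival π x θ s * meanRate π x s := by
    rw [← lintegral_const_mul' _ _ (survival_ne_top π x u θ)]
    refine setLIntegral_congr_fun measurableSet_Ioc fun s hs => ?_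
    rw [← survival_mul π x h1 hs.1.le, mul_assoc]
  rw [h, ← survival_mul π x h1 h2, ← mul_add, lintegral_survival_mul_meanRate_add π x h2, mul_one]

/-- Integration by parts: a running cost that is paid at the jump, or at `t` if there is none,
is the cost paid continuously up to the jump. -/
theorem lintegral_mul_survival_add (x : S) {φ : ℝ → ℝ≥0∞} (hφ : Measurable φ) (u t : ℝ) :
    (∫⁻ θ in Ioc u t, φ θ) * survival π x u t
      + ∫⁻ s in Ioc u t, survival π x u s * (meanRate π x s * ∫⁻ θ in Ioc u s, φ θ)
      = ∫⁻ s in Ioc u t, survival π x u s * φ s := by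
  have hm := measurable_meanRate_right π x
  have hs := measurable_survival_right π x u
  -- Tonelli on the triangle u < θ ≤ s ≤ t. For fixed θ, the jump density over [θ, t] together with
  -- the survival probability at t gives the survival probability at θ.
  have h1 : ∫⁻ s in Ioc u t, survival π x u s * (meanRate π x s * ∫⁻ θ in Ioc u s, φ θ)
      = ∫⁻ s in Ioc u t, ∫⁻ θ in Ioc u t,
          (Ici θ).indicator (fun s => survival π x u s * meanRate π x s) s * φ θ := by
    refine setLIntegral_congr_fun measurableSet_Ioc fun s hsm => ?_
    rw [← mul_assoc, ← lintegral_const_mul _ hφ, ← lintegral_indicator measurableSet_Ioc,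
      ← lintegral_indicator measurableSet_Ioc]
    refine lintegral_congr fun θ => ?_
    by_cases h : θ ∈ Ioc u s
    · rw [indicator_of_mem h, indicator_of_mem (show θ ∈ Ioc u t from ⟨h.1, h.2.trans hsm.2⟩),
        indicator_of_mem (show s ∈ Ici θ from h.2)]
    · rw [indicator_of_notMem h]
      by_cases h' : θ ∈ Ioc u t
      · rw [indicator_of_mem h', indicator_of_notMem (show s ∉ Ici θ from fun h2 => h ⟨h'.1, h2⟩), zero_mul]
      · rw [indicator_of_notMem h']
  have hmeas : Measurable (Function.uncurry fun s θ =>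
      (Ici θ).indicator (fun s => survival π x u s * meanRate π x s) s * φ θ) := by
    refine Measurable.mul (Measurable.indicator (s := {p : ℝ × ℝ | p.2 ≤ p.1})
      (f := fun p : ℝ × ℝ => survival π x u p.1 * meanRate π x p.1) (by fun_prop)
      (measurableSet_le measurable_snd measurable_fst)) (by fun_prop)
  rw [h1, lintegral_lintegral_swap hmeas.aemeasurable, ← lintegral_mul_const _ hφ,
    ← lintegral_add_left (by fun_prop)]
  refine setLIntegral_congr_fun measurableSet_Ioc fun θ hθ => ?_
  rw [lintegral_mul_const _ (Measurable.indicator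
    (f := fun s => survival π x u s * meanRate π x s) (by fun_prop) measurableSet_Ici), mul_comm (φ θ), ← add_mul]
  congr 1
  rw [← lintegral_survival_mul_meanRate_add' π x hθ.1.le hθ.2, add_comm]
  congr 1
  rw [lintegral_indicator measurableSet_Ici, Measure.restrict_restrict measurableSet_Ici]
  have : (Ici θ ∩ Ioc u t) = Icc θ t := by
    ext s
    simp only [mem_inter_iff, mem_Ici, mem_Ioc, mem_Icc]
    exact ⟨fun h => ⟨h.1, h.2.2⟩, fun h => ⟨h.1, hθ.1.trans_le h.1, h.2⟩⟩
  rw [this]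
  exact setLIntegral_congr Ioc_ae_eq_Icc.symm

end Survival

/-! ### Iterates of the jump kernel and the occupation kernel. -/

section Occupation

theorem jumpKernel_apply_Iic (z : ℝ × S) : jumpKernel π z {w | w.1 ≤ z.1} = 0 := by
  have hm : MeasurableSet {w : ℝ × S | w.1 ≤ z.1} :=
    measurableSet_le measurable_fst measurable_const
  rw [← lintegral_indicator_one hm, lintegral_jumpKernel π z (measurable_one.indicator hm)]
  refine (setLIntegral_congr_fun measurableSet_Ioi fun s hs => ?_).trans lintegral_zero
  have : (fun y : S => {w : ℝ × S | w.1 ≤ z.1}.indicator (1 : ℝ × S → ℝ≥0∞) (s, y))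
      = fun _ => 0 := by
    ext y
    exact indicator_of_notMem (s := {w : ℝ × S | w.1 ≤ z.1}) (not_le.2 (mem_Ioi.1 hs)) 1
  simp [this]

theorem ae_jumpKernel_lt (z : ℝ × S) : ∀ᵐ w ∂jumpKernel π z, z.1 < w.1 := by
  rw [ae_iff]
  simpa using jumpKernel_apply_Iic π z

instance isFiniteKernel_jumpKernel : IsFiniteKernel (jumpKernel π) :=
  ⟨⟨1, ENNReal.one_lt_top, jumpKernel_univ_le π⟩⟩

/-- The law of `(t_n, x_n)` on `{t_n < ∞}` when the process enters `x_0` at the moment `t_0`. -/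
noncomputable def jumpIter : ℕ → Kernel (ℝ × S) (ℝ × S)
  | 0 => Kernel.id
  -- The single jump is applied first and the other `n` afterwards, so induction peels off the first
  -- jump, as the integral inequality does.
  | n + 1 => jumpIter n ∘ₖ jumpKernel π

instance isFiniteKernel_jumpIter (n : ℕ) : IsFiniteKernel (jumpIter π n) := by
  induction n with
  | zero => rw [jumpIter]; infer_instance
  | succ n ih => rw [jumpIter]; infer_instance

/-- The occupation kernel of the jumps: the expected number of `n` with `(t_n, x_n)` in a given
set. -/
noncomputable def occupation : Kernel (ℝ × S) (ℝ × S) := Kernel.sum (jumpIter π)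

instance isSFiniteKernel_occupation : IsSFiniteKernel (occupation π) := by
  rw [occupation]; infer_instance

theorem lintegral_occupation (z : ℝ × S) (f : ℝ × S → ℝ≥0∞) :
    ∫⁻ w, f w ∂occupation π z = ∑' n, ∫⁻ w, f w ∂jumpIter π n z := by
  rw [occupation, Kernel.sum_apply, lintegral_sum_measure]

theorem lintegral_jumpIter_zero (z : ℝ × S) {f : ℝ × S → ℝ≥0∞} (hf : Measurable f) :
    ∫⁻ w, f w ∂jumpIter π 0 z = f z := by
  rw [jumpIter, Kernel.id_apply, lintegral_dirac' _ hf]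

theorem lintegral_jumpIter_succ (n : ℕ) (z : ℝ × S) {f : ℝ × S → ℝ≥0∞} (hf : Measurable f) :
    ∫⁻ w, f w ∂jumpIter π (n + 1) z
      = ∫⁻ z', ∫⁻ w, f w ∂jumpIter π n z' ∂jumpKernel π z := by
  rw [jumpIter, Kernel.lintegral_comp _ _ _ hf]

/-- Decomposition of the occupation kernel at the first jump. -/
theorem lintegral_occupation_eq_add (z : ℝ × S) {f : ℝ × S → ℝ≥0∞} (hf : Measurable f) :
    ∫⁻ w, f w ∂occupation π z
      = f z + ∫⁻ z', ∫⁻ w, f w ∂occupation π z' ∂jumpKernel π z := by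
  simp_rw [lintegral_occupation π]
  rw [tsum_eq_zero_add' ENNReal.summable, lintegral_jumpIter_zero π z hf,
    lintegral_tsum fun n => hf.lintegral_kernel.aemeasurable]
  simp_rw [lintegral_jumpIter_succ π _ _ hf]

theorem ae_jumpIter_le (n : ℕ) (z : ℝ × S) : ∀ᵐ w ∂jumpIter π n z, z.1 ≤ w.1 := by
  have hm : ∀ r : ℝ, MeasurableSet {w : ℝ × S | w.1 < r} := fun r =>
    measurableSet_lt measurable_fst measurable_const
  induction n generalizing z with
  | zero =>
    rw [jumpIter, Kernel.id_apply, ae_dirac_iff (measurableSet_le measurable_const measurable_fst)]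
  | succ n ih =>
    rw [ae_iff]
    simp only [not_le]
    rw [jumpIter, Kernel.comp_apply' _ _ _ (hm _), lintegral_eq_zero_iff
      (Kernel.measurable_coe _ (hm _))]
    filter_upwards [ae_jumpKernel_lt π z] with z' hz'
    have := ih z'
    rw [ae_iff] at this
    simp only [not_le] at this
    exact measure_mono_null (fun w (hw : w.1 < z.1) => hw.trans hz') this

theorem ae_occupation_le (z : ℝ × S) : ∀ᵐ w ∂occupation π z, z.1 ≤ w.1 := by
  rw [occupation, Kernel.sum_apply, Measure.ae_sum_iff]
  exact fun n => ae_jumpIter_le π n z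

end Occupation

/-! ### The Markov chain of marks. -/

section Chain

/-- A function of the jump `(t_n, x_n)`, extended by zero to the mark `(∞, x_∞)`. -/
def extendZero {Ω : Type*} (f : Ω → ℝ≥0∞) : Ω ⊕ Unit → ℝ≥0∞ := Sum.elim f fun _ => 0

theorem measurable_extendZero {Ω : Type*} [MeasurableSpace Ω] {f : Ω → ℝ≥0∞}
    (hf : Measurable f) : Measurable (extendZero f) :=
  hf.sumElim measurable_const

theorem nextMark_inl (z : ℝ × S) : nextMark π (Sum.inl z) = (jumpKernel π z).map Sum.inl
    + (1 - jumpKernel π z univ) • Measure.dirac (Sum.inr ()) := rfl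

theorem nextMark_inr (i : Unit) : nextMark π (Sum.inr i) = Measure.dirac (Sum.inr ()) := rfl

theorem lintegral_nextMark_inl (z : ℝ × S) {g : Mark S → ℝ≥0∞} (hg : Measurable g) :
    ∫⁻ m, g m ∂nextMark π (Sum.inl z)
      = ∫⁻ w, g (Sum.inl w) ∂jumpKernel π z + (1 - jumpKernel π z univ) * g (Sum.inr ()) := by
  rw [nextMark_inl, lintegral_add_measure, lintegral_map hg measurable_inl, lintegral_smul_measure,
    lintegral_dirac' _ hg, smul_eq_mul]

theorem lintegral_nextMark_inr (i : Unit) {g : Mark S → ℝ≥0∞} (hg : Measurable g) :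
    ∫⁻ m, g m ∂nextMark π (Sum.inr i) = g (Sum.inr ()) := by
  rw [nextMark_inr, lintegral_dirac' _ hg]

/-- The cemetery is absorbing, so functions vanishing there are stable under `nextMark`, which acts
on them as the sub-probability kernel `jumpKernel`. -/
theorem lintegral_nextMark_extendZero {f : ℝ × S → ℝ≥0∞} (hf : Measurable f) (m : Mark S) :
    ∫⁻ m', extendZero f m' ∂nextMark π m = extendZero (fun z => ∫⁻ w, f w ∂jumpKernel π z) m := by
  rcases m with z | i
  · rw [lintegral_nextMark_inl π z (measurable_extendZero hf)]
    simp [extendZero]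
  · rw [lintegral_nextMark_inr π i (measurable_extendZero hf)]
    rfl

theorem measurable_jumpTime : Measurable (jumpTime (S := S)) :=
  Measurable.sumElim (measurable_coe_real_ereal.comp measurable_fst) measurable_const

theorem ae_nextMark_le (m : Mark S) : ∀ᵐ m' ∂nextMark π m, jumpTime m ≤ jumpTime m' := by
  have hs : MeasurableSet {m' : Mark S | jumpTime m ≤ jumpTime m'} :=
    measurableSet_le measurable_const measurable_jumpTime
  rcases m with z | i
  · rw [nextMark_inl, ae_add_measure_iff]
    constructor
    · rw [ae_map_iff measurable_inl.aemeasurable hs]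
      filter_upwards [ae_jumpKernel_lt π z] with w hw
      exact EReal.coe_le_coe_iff.2 hw.le
    · refine Measure.ae_smul_measure ?_ _
      rw [ae_dirac_iff hs]
      exact le_top
  · rw [nextMark_inr, ae_dirac_iff hs]

variable (γ : Measure S) [IsProbabilityMeasure γ]

instance isProbabilityMeasure_map_inl :
    IsProbabilityMeasure (γ.map fun x => (Sum.inl (0, x) : Mark S)) :=
  Measure.isProbabilityMeasure_map (by fun_prop)

instance isProbabilityMeasure_law : IsProbabilityMeasure (law π γ) := by
  rw [law]; infer_instance

theorem map_frestrictLe_law_compProd (a : ℕ) :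
    (law π γ).map (Preorder.frestrictLe a) ⊗ₘ
      (nextMark π).comap (fun h : (i : Finset.Iic a) → Mark S => h ⟨a, Finset.mem_Iic.2 le_rfl⟩)
        (measurable_pi_apply _)
      = (law π γ).map fun ω => (Preorder.frestrictLe a ω, ω (a + 1)) :=
  Kernel.map_frestrictLe_trajMeasure_compProd_eq_map_trajMeasure

/-- The Markov property of the sequence of marks. -/
theorem lintegral_law_mul_succ (a : ℕ) {F : ((i : Finset.Iic a) → Mark S) → ℝ≥0∞}
    (hF : Measurable F) {g : Mark S → ℝ≥0∞} (hg : Measurable g) :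
    ∫⁻ ω, F (Preorder.frestrictLe a ω) * g (ω (a + 1)) ∂law π γ
      = ∫⁻ ω, F (Preorder.frestrictLe a ω) * ∫⁻ m, g m ∂nextMark π (ω a) ∂law π γ := by
  have h := congrArg (fun μ => ∫⁻ p, F p.1 * g p.2 ∂μ) (map_frestrictLe_law_compProd π γ a)
  rw [lintegral_map (by fun_prop) (by fun_prop), Measure.lintegral_compProd (by fun_prop),
    lintegral_map _ (by fun_prop)] at h
  · rw [← h]
    refine lintegral_congr fun ω => ?_
    exact lintegral_const_mul (μ := nextMark π (ω a)) (F (Preorder.frestrictLe a ω)) hg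
  · exact Measurable.lintegral_kernel_prod_right' (f := fun p : _ × Mark S => F p.1 * g p.2)
      (by fun_prop)

/-- The law lives on all sequences of marks. Sequences with decreasing jump times must be discarded
before sojourns can be treated as disjoint. Only weak monotonicity is claimed, since the time ∞
repeats. -/
theorem ae_law_mono : ∀ᵐ ω ∂law π γ, Monotone fun n => jumpTime (ω n) := by
  have h : ∀ n, ∀ᵐ ω ∂law π γ, jumpTime (ω n) ≤ jumpTime (ω (n + 1)) := by
    intro a
    have hs : MeasurableSet {p : ((i : Finset.Iic a) → Mark S) × Mark S |
        jumpTime (p.1 ⟨a, Finset.mem_Iic.2 le_rfl⟩) ≤ jumpTime p.2} :=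
      measurableSet_le (measurable_jumpTime.comp (by fun_prop))
        (measurable_jumpTime.comp (by fun_prop))
    have h1 : ∀ᵐ p ∂(law π γ).map fun ω => (Preorder.frestrictLe a ω, ω (a + 1)),
        jumpTime (p.1 ⟨a, Finset.mem_Iic.2 le_rfl⟩) ≤ jumpTime p.2 := by
      rw [← map_frestrictLe_law_compProd π γ a, Measure.ae_compProd_iff hs]
      exact ae_of_all _ fun p => ae_nextMark_le π _
    rw [ae_map_iff (by fun_prop) hs] at h1
    exact h1
  filter_upwards [ae_all_iff.2 h] with ω hω
  exact monotone_nat_of_le_succ hω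

theorem map_zero_law : (law π γ).map (fun ω => ω 0) = γ.map fun x => Sum.inl (0, x) := by
  have h : (law π γ).map (Preorder.frestrictLe 0)
      = (γ.map fun x => (Sum.inl (0, x) : Mark S)).map
        (MeasurableEquiv.piUnique (fun _ : Finset.Iic 0 => Mark S)).symm := by
    rw [law, Kernel.trajMeasure, Measure.map_comp _ _ (Preorder.measurable_frestrictLe 0),
      Kernel.traj_map_frestrictLe, Kernel.partialTraj_self, Measure.id_comp]
  have h2 := congrArg (fun μ => μ.map
    fun p : (i : Finset.Iic 0) → Mark S => p ⟨0, Finset.mem_Iic.2 le_rfl⟩) h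
  rw [Measure.map_map (by fun_prop) (by fun_prop), Measure.map_map (by fun_prop) (by fun_prop)]
    at h2
  refine h2.trans ?_
  convert Measure.map_id using 2
  funext m
  exact (MeasurableEquiv.piUnique (fun _ : Finset.Iic 0 => Mark S)).apply_symm_apply m

theorem lintegral_law_zero {g : Mark S → ℝ≥0∞} (hg : Measurable g) :
    ∫⁻ ω, g (ω 0) ∂law π γ = ∫⁻ x, g (Sum.inl (0, x)) ∂γ := by
  have h := congrArg (fun μ => ∫⁻ m, g m ∂μ) (map_zero_law π γ)
  rwa [lintegral_map hg (by fun_prop), lintegral_map hg (by fun_prop)] at h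

/-- The Markov property over `k` steps. A function of the history up to `a` is also one of the
history up to `a + 1`, so the induction hypothesis applies from `a + 1`, and one more step leads
back to `a`. -/
theorem lintegral_law_mul_add (a k : ℕ) {F : ((i : Finset.Iic a) → Mark S) → ℝ≥0∞}
    (hF : Measurable F) {f : ℝ × S → ℝ≥0∞} (hf : Measurable f) :
    ∫⁻ ω, F (Preorder.frestrictLe a ω) * extendZero f (ω (a + k)) ∂law π γ
      = ∫⁻ ω, F (Preorder.frestrictLe a ω)
          * extendZero (fun z => ∫⁻ w, f w ∂jumpIter π k z) (ω a) ∂law π γ := by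
  induction k generalizing a with
  | zero => simp_rw [lintegral_jumpIter_zero π _ hf, add_zero]
  | succ k ih =>
    have h1 := ih (a + 1) (F := fun p => F (Preorder.frestrictLe₂ (π := fun _ => Mark S) (Nat.le_succ a) p))
      (hF.comp (Preorder.measurable_frestrictLe₂ _))
    rw [show a + (k + 1) = a + 1 + k by ring]
    refine h1.trans ?_
    refine (lintegral_law_mul_succ π γ a hF
      (measurable_extendZero (hf.lintegral_kernel (κ := jumpIter π k)))).trans ?_
    simp_rw [lintegral_nextMark_extendZero π (hf.lintegral_kernel (κ := jumpIter π k)),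
      lintegral_jumpIter_succ π _ _ hf]

end Chain

/-! ### Pathwise decomposition into sojourns. -/

section Paths

open Classical in
/-- `I{m happens after t}`. -/
noncomputable def late (t : ℝ) (m : Mark S) : ℝ≥0∞ := if (t : EReal) < jumpTime m then 1 else 0

open Classical in
/-- `I{r ≤ t} f(x)` for a jump at the moment `r` into the state `x`. -/
noncomputable def early (t : ℝ) (f : S → ℝ≥0∞) (w : ℝ × S) : ℝ≥0∞ := if w.1 ≤ t then f w.2 else 0

open Classical in
/-- `I{r ≤ t} f(x) exp(-∫_r^t ∫ q_x(a) π(da|x,θ) dθ)` for a jump at the moment `r` into the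
state `x`. -/
noncomputable def alive (t : ℝ) (f : S → ℝ≥0∞) (w : ℝ × S) : ℝ≥0∞ :=
  if w.1 ≤ t then f w.2 * survival π w.2 w.1 t else 0

theorem measurable_late (t : ℝ) : Measurable (late (S := S) t) :=
  Measurable.ite (measurableSet_lt measurable_const measurable_jumpTime) measurable_const
    measurable_const

theorem measurable_early (t : ℝ) {f : S → ℝ≥0∞} (hf : Measurable f) : Measurable (early t f) :=
  Measurable.ite (measurableSet_le measurable_fst measurable_const) (hf.comp measurable_snd)
    measurable_const

theorem measurable_alive_uncurry {f : S × ℝ → ℝ≥0∞} (hf : Measurable f) :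
    Measurable fun p : (ℝ × S) × ℝ => alive π p.2 (fun y => f (y, p.2)) p.1 :=
  Measurable.ite (measurableSet_le (by fun_prop) (by fun_prop))
    (Measurable.mul (hf.comp (f := fun p : (ℝ × S) × ℝ => (p.1.2, p.2)) (by fun_prop))
      (measurable_survival π)) measurable_const

theorem measurable_alive (t : ℝ) {f : S → ℝ≥0∞} (hf : Measurable f) : Measurable (alive π t f) :=
  (measurable_alive_uncurry π (hf.comp measurable_fst)).comp
    (f := fun w : ℝ × S => (w, t)) (by fun_prop)

/-- The contribution of the sojourn after the `n`-th jump to `f(ξ_t)`. -/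
noncomputable def visit (t : ℝ) (f : S → ℝ≥0∞) (ω : ℕ → Mark S) (n : ℕ) : ℝ≥0∞ :=
  extendZero (early t f) (ω n) * late t (ω (n + 1))

theorem measurable_visit (t : ℝ) {f : S → ℝ≥0∞} (hf : Measurable f) (n : ℕ) :
    Measurable fun ω : ℕ → Mark S => visit t f ω n :=
  ((measurable_extendZero (measurable_early t hf)).comp (measurable_pi_apply n)).mul
    ((measurable_late t).comp (measurable_pi_apply (n + 1)))

theorem visit_of_mem {t : ℝ} (f : S → ℝ≥0∞) {ω : ℕ → Mark S} {n : ℕ}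
    (h : jumpTime (ω n) ≤ t ∧ (t : EReal) < jumpTime (ω (n + 1))) :
    visit t f ω n = extendZero f (Sum.map Prod.snd id (ω n)) := by
  rw [visit, late, if_pos h.2, mul_one]
  have h1 := h.1
  revert h1
  generalize ω n = m
  intro h1
  rcases m with w | i
  · exact if_pos (EReal.coe_le_coe_iff.1 h1)
  · rfl

theorem visit_of_notMem {t : ℝ} (f : S → ℝ≥0∞) {ω : ℕ → Mark S} {n : ℕ}
    (h : ¬(jumpTime (ω n) ≤ t ∧ (t : EReal) < jumpTime (ω (n + 1)))) :
    visit t f ω n = 0 := by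
  rw [visit, late]
  split_ifs with h2
  · have h1 : ¬ jumpTime (ω n) ≤ t := fun h1 => h ⟨h1, h2⟩
    revert h1
    generalize ω n = m
    intro h1
    rw [mul_one]
    rcases m with w | i
    · exact if_neg fun h' => h1 (EReal.coe_le_coe_iff.2 h')
    · rfl
  · rw [mul_zero]

/-- Along a monotone sequence the intervals [t_n, t_{n+1}) are disjoint, so at most one term is
nonzero. If no interval contains `t`, the process is in the cemetery and both sides vanish. -/
theorem extendZero_process {ω : ℕ → Mark S} (hω : Monotone fun n => jumpTime (ω n)) (t : ℝ)
    (f : S → ℝ≥0∞) : extendZero f (process t ω) = ∑' n, visit t f ω n := by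
  classical
  by_cases h : ∃ n, jumpTime (ω n) ≤ t ∧ (t : EReal) < jumpTime (ω (n + 1))
  · obtain ⟨n, hn, hp⟩ : ∃ n, (jumpTime (ω n) ≤ t ∧ (t : EReal) < jumpTime (ω (n + 1))) ∧
        process t ω = Sum.map Prod.snd id (ω n) := ⟨Nat.find h, Nat.find_spec h, dif_pos h⟩
    rw [hp, tsum_eq_single n, visit_of_mem f hn]
    intro m hm
    refine visit_of_notMem f fun hmt => ?_
    rcases lt_or_gt_of_ne hm with hlt | hlt
    · have h1 : jumpTime (ω (m + 1)) ≤ jumpTime (ω n) := hω (Nat.succ_le_of_lt hlt)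
      exact absurd (hmt.2.trans_le (h1.trans hn.1)) (lt_irrefl _)
    · have h1 : jumpTime (ω (n + 1)) ≤ jumpTime (ω m) := hω (Nat.succ_le_of_lt hlt)
      exact absurd (hn.2.trans_le (h1.trans hmt.1)) (lt_irrefl _)
  · rw [process, dif_neg h, ENNReal.tsum_eq_zero.2 fun n => visit_of_notMem f fun hn => h ⟨n, hn⟩]
    rfl

/-- If `u` falls in the `n`-th sojourn, then at `t ≥ u` the process is still in that sojourn (first
summand), in a later one (the series), or in the cemetery. Earlier sojourns are over. -/
theorem visit_mul_extendZero_process {ω : ℕ → Mark S} (hω : Monotone fun n => jumpTime (ω n))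
    {u t : ℝ} (hut : u ≤ t) (f f' : S → ℝ≥0∞) (n : ℕ) :
    visit u f ω n * extendZero f' (process t ω)
      = extendZero (early u fun y => f y * f' y) (ω n) * late t (ω (n + 1))
        + ∑' k, visit u f ω n * visit t f' ω (n + 1 + k) := by
  have hut' : (u : EReal) ≤ t := EReal.coe_le_coe_iff.2 hut
  by_cases h : jumpTime (ω n) ≤ u ∧ (u : EReal) < jumpTime (ω (n + 1))
  · have h0 : ∀ m, m < n → visit t f' ω m = 0 := fun m hm => visit_of_notMem f' fun hmt =>
      absurd (hmt.2.trans_le ((hω (Nat.succ_le_of_lt hm)).trans (h.1.trans hut'))) (lt_irrefl _)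
    have hsum : ∑' m, visit t f' ω m = ∑ m ∈ Finset.range (n + 1), visit t f' ω m
        + ∑' k, visit t f' ω (k + (n + 1)) :=
      (Summable.sum_add_tsum_nat_add' (f := visit t f' ω) ENNReal.summable).symm
    rw [extendZero_process hω, hsum,
      Finset.sum_range_succ, Finset.sum_eq_zero fun m hm => h0 m (Finset.mem_range.1 hm), zero_add,
      mul_add, ENNReal.tsum_mul_left]
    congr 1
    · rw [visit_of_mem f h, visit, ← mul_assoc]
      congr 1
      have h1 := h.1
      revert h1
      generalize ω n = m
      intro h1
      rcases m with w | i
      · have h2 : w.1 ≤ u := EReal.coe_le_coe_iff.1 h1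
        simp [extendZero, early, h2, h2.trans hut]
      · simp [extendZero]
    · simp_rw [add_comm (n + 1)]
  · have h1 : extendZero (early u fun y => f y * f' y) (ω n) * late t (ω (n + 1)) = 0 := by
      rw [late]
      split_ifs with h2
      · have h3 := visit_of_notMem (fun y => f y * f' y) h
        rwa [visit, late, if_pos (hut'.trans_lt h2)] at h3
      · rw [mul_zero]
    rw [visit_of_notMem f h, h1]
    simp

end Paths

/-! ### One-dimensional distributions. -/

section OneTime

/-- The complementary event is a finite jump by `t`, whose probability is the integral of the jump
density, that is, one minus the survival probability. Passing to the complement also accounts for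
the mass of the cemetery. -/
theorem lintegral_nextMark_late {z : ℝ × S} {t : ℝ} (h : z.1 ≤ t) :
    ∫⁻ m, late t m ∂nextMark π (Sum.inl z) = survival π z.2 z.1 t := by
  have he := measurable_early (S := S) t (f := fun _ => 1) measurable_const
  have h1 : ∀ m : Mark S, late t m + extendZero (early t fun _ => 1) m = 1 := by
    rintro (w | i)
    · change late t (Sum.inl w) + early t (fun _ => 1) w = 1
      have hw : (t : EReal) < jumpTime (Sum.inl w : Mark S) ↔ ¬ w.1 ≤ t :=
        EReal.coe_lt_coe_iff.trans not_le.symm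
      by_cases h' : w.1 ≤ t <;> simp [late, early, hw, h']
    · have hi : (t : EReal) < jumpTime (Sum.inr i : Mark S) := EReal.coe_lt_top t
      rw [late, if_pos hi]
      exact add_zero 1
  have h2 : ∫⁻ m, extendZero (early t fun _ => 1) m ∂nextMark π (Sum.inl z)
      = ∫⁻ s in Ioc z.1 t, survival π z.2 z.1 s * meanRate π z.2 s := by
    rw [lintegral_nextMark_extendZero π he]
    change ∫⁻ w, early t (fun _ => 1) w ∂jumpKernel π z = _
    rw [lintegral_jumpKernel π z he, ← Ioi_inter_Iic, inter_comm,
      ← Measure.restrict_restrict measurableSet_Iic, ← lintegral_indicator measurableSet_Iic]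
    refine lintegral_congr fun s => ?_
    by_cases hs : s ≤ t
    · rw [indicator_of_mem (show s ∈ Iic t from hs)]
      simp [early, hs, jumpRate_univ]
    · rw [indicator_of_notMem (show s ∉ Iic t from hs)]
      simp [early, hs]
  have h3 := lintegral_survival_mul_meanRate_add π z.2 h
  have h4 : ∫⁻ m, (late t m + extendZero (early t fun _ => 1) m) ∂nextMark π (Sum.inl z) = 1 := by
    simp_rw [h1]
    rw [lintegral_one, measure_univ]
  rw [lintegral_add_left (measurable_late t), h2, ← h3, add_comm] at h4
  refine (ENNReal.add_right_inj (ne_top_of_le_ne_top ENNReal.one_ne_top ?_)).1 h4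
  rw [← h3]
  exact le_self_add

/-- Given the `n`-th mark, the only remaining condition is that the next jump is later than `t`,
which turns `early` into `alive`. -/
theorem lintegral_law_visit (γ : Measure S) [IsProbabilityMeasure γ] (t : ℝ) {f : S → ℝ≥0∞}
    (hf : Measurable f) (n : ℕ) :
    ∫⁻ ω, visit t f ω n ∂law π γ = ∫⁻ ω, extendZero (alive π t f) (ω n) ∂law π γ := by
  refine (lintegral_law_mul_succ π γ n
    (F := fun p => extendZero (early t f) (p ⟨n, Finset.mem_Iic.2 le_rfl⟩))
    ((measurable_extendZero (measurable_early t hf)).comp (measurable_pi_apply _))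
    (measurable_late t)).trans (lintegral_congr fun ω => ?_)
  change extendZero (early t f) (ω n) * _ = _
  rcases ω n with w | i
  · change early t f w * _ = alive π t f w
    rw [early, alive]
    split_ifs with h
    · rw [lintegral_nextMark_late π h]
    · rw [zero_mul]
  · exact zero_mul _

theorem lintegral_law_process_eq_tsum (γ : Measure S) [IsProbabilityMeasure γ] (t : ℝ)
    {f : S → ℝ≥0∞} (hf : Measurable f) :
    ∫⁻ ω, extendZero f (process t ω) ∂law π γ
      = ∑' n, ∫⁻ ω, extendZero (alive π t f) (ω n) ∂law π γ := by
  simp_rw [← lintegral_law_visit π γ t hf]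
  rw [← lintegral_tsum fun n => (measurable_visit t hf n).aemeasurable]
  refine lintegral_congr_ae ?_
  filter_upwards [ae_law_mono π γ] with ω hω
  exact extendZero_process hω t f

/-- The one-dimensional distributions of the jump process. -/
theorem lintegral_law_process (γ : Measure S) [IsProbabilityMeasure γ] (t : ℝ)
    {f : S → ℝ≥0∞} (hf : Measurable f) :
    ∫⁻ ω, extendZero f (process t ω) ∂law π γ
      = ∫⁻ x, ∫⁻ w, alive π t f w ∂occupation π (0, x) ∂γ := by
  have ha := measurable_alive π t hf
  rw [lintegral_law_process_eq_tsum π γ t hf]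
  simp_rw [lintegral_occupation]
  rw [lintegral_tsum fun n => Measurable.aemeasurable (f := fun x : S =>
    ∫⁻ w, alive π t f w ∂jumpIter π n (0, x)) (ha.lintegral_kernel.comp
      (f := fun x : S => ((0 : ℝ), x)) (by fun_prop))]
  refine tsum_congr fun n => ?_
  have h := lintegral_law_mul_add π γ 0 n (F := fun _ => 1) measurable_const ha
  simp only [one_mul, zero_add] at h
  rw [h, lintegral_law_zero π γ (measurable_extendZero ha.lintegral_kernel)]
  rfl

end OneTime

/-! ### Two-dimensional distributions and the Markov property at a fixed time. -/

section TwoTimes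

variable (γ : Measure S) [IsProbabilityMeasure γ]

theorem measurable_lintegral_occupation_alive (t : ℝ) {f : S → ℝ≥0∞} (hf : Measurable f) :
    Measurable fun z => ∫⁻ w, alive π t f w ∂occupation π z :=
  (measurable_alive π t hf).lintegral_kernel

/-- The jump ending the later sojourn is integrated out first, giving `alive` at the mark n + 1 + k.
The `k`-step Markov property then carries this back to the mark n + 1, where the visit at `u` is
already decided. -/
theorem lintegral_law_visit_mul_visit (u t : ℝ) {f f' : S → ℝ≥0∞}
    (hf : Measurable f) (hf' : Measurable f') (n k : ℕ) :
    ∫⁻ ω, visit u f ω n * visit t f' ω (n + 1 + k) ∂law π γ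
      = ∫⁻ ω, visit u f ω n
          * extendZero (fun z => ∫⁻ w, alive π t f' w ∂jumpIter π k z) (ω (n + 1)) ∂law π γ := by
  have he := measurable_extendZero (measurable_early u hf)
  have he' := measurable_extendZero (measurable_early t hf')
  have hl := measurable_late (S := S)
  have h1 := lintegral_law_mul_succ π γ (n + 1 + k)
    (F := fun p => extendZero (early u f) (p ⟨n, Finset.mem_Iic.2 (by omega)⟩)
      * late u (p ⟨n + 1, Finset.mem_Iic.2 (by omega)⟩)
      * extendZero (early t f') (p ⟨n + 1 + k, Finset.mem_Iic.2 le_rfl⟩))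
    (by fun_prop) (hl t)
  have h2 := lintegral_law_mul_add π γ (n + 1) k
    (F := fun p => extendZero (early u f) (p ⟨n, Finset.mem_Iic.2 (by omega)⟩)
      * late u (p ⟨n + 1, Finset.mem_Iic.2 (by omega)⟩))
    (by fun_prop) (measurable_alive π t hf')
  refine Eq.trans (lintegral_congr fun ω => (mul_assoc _ _ _).symm) (h1.trans (Eq.trans ?_ h2))
  refine lintegral_congr fun ω => ?_
  rw [mul_assoc]
  congr 1
  change extendZero (early t f') (ω (n + 1 + k)) * _ = extendZero (alive π t f') (ω (n + 1 + k))
  rcases ω (n + 1 + k) with w | i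
  · change early t f' w * _ = alive π t f' w
    rw [early, alive]
    split_ifs with h
    · rw [lintegral_nextMark_late π h]
    · rw [zero_mul]
  · exact zero_mul _

/-- Lack of memory: survival from `z.1` to s > u factors through `u`, and the jump rate at s does
not depend on when the state was entered. -/
theorem lintegral_nextMark_late_mul {z : ℝ × S} {u : ℝ} (h : z.1 ≤ u) {f : ℝ × S → ℝ≥0∞}
    (hf : Measurable f) :
    ∫⁻ m, late u m * extendZero f m ∂nextMark π (Sum.inl z)
      = survival π z.2 z.1 u * ∫⁻ w, f w ∂jumpKernel π (u, z.2) := by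
  have hm : MeasurableSet {w : ℝ × S | u < w.1} := measurableSet_lt measurable_const measurable_fst
  have h1 : ∀ m : Mark S, late u m * extendZero f m
      = extendZero ({w : ℝ × S | u < w.1}.indicator f) m := by
    rintro (w | i)
    · change late u (Sum.inl w) * f w = {w : ℝ × S | u < w.1}.indicator f w
      have hw : (u : EReal) < jumpTime (Sum.inl w : Mark S) ↔ u < w.1 := EReal.coe_lt_coe_iff
      by_cases h' : u < w.1 <;> simp [late, hw, h']
    · exact mul_zero _
  simp_rw [h1]
  rw [lintegral_nextMark_extendZero π (hf.indicator hm)]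
  change ∫⁻ w, {w : ℝ × S | u < w.1}.indicator f w ∂jumpKernel π z = _
  rw [lintegral_jumpKernel π z (hf.indicator hm), lintegral_jumpKernel π _ hf,
    ← lintegral_const_mul' _ _ (survival_ne_top π _ _ _), ← lintegral_indicator measurableSet_Ioi,
    ← lintegral_indicator measurableSet_Ioi]
  refine lintegral_congr fun s => ?_
  by_cases hs : u < s
  · rw [indicator_of_mem (show s ∈ Ioi z.1 from h.trans_lt hs),
      indicator_of_mem (show s ∈ Ioi (u, z.2).1 from hs), ← mul_assoc, survival_mul π z.2 h hs.le]
    simp [hs]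
  · rw [indicator_of_notMem (show s ∉ Ioi (u, z.2).1 from hs)]
    by_cases hs' : z.1 < s
    · rw [indicator_of_mem (show s ∈ Ioi z.1 from hs')]
      simp [hs]
    · rw [indicator_of_notMem (show s ∉ Ioi z.1 from hs')]

/-- The Markov property of the jump process at the moment `u`. -/
theorem lintegral_law_process_mul_process {u t : ℝ} (hut : u ≤ t) {f f' : S → ℝ≥0∞}
    (hf : Measurable f) (hf' : Measurable f') :
    ∫⁻ ω, extendZero f (process u ω) * extendZero f' (process t ω) ∂law π γ
      = ∫⁻ ω, extendZero (fun y => f y * ∫⁻ w, alive π t f' w ∂occupation π (u, y))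
          (process u ω) ∂law π γ := by
  have hQ := measurable_lintegral_occupation_alive π t hf'
  have hp := measurable_extendZero hf'
  have hpr := measurable_process (S := S) t
  have hl := measurable_late (S := S)
  have hff : Measurable fun y => f y * f' y := hf.mul hf'
  have hee := measurable_extendZero (measurable_early u hff)
  have he := measurable_extendZero (measurable_early u hf)
  have hv := fun n => measurable_visit u hf n
  have hv' := fun n => measurable_visit t hf' n
  rw [lintegral_law_process_eq_tsum π γ u
    (f := fun y => f y * ∫⁻ w, alive π t f' w ∂occupation π (u, y))
    (hf.mul (hQ.comp (f := fun y : S => (u, y)) (by fun_prop)))]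
  have h1 : ∫⁻ ω, extendZero f (process u ω) * extendZero f' (process t ω) ∂law π γ
      = ∑' n, ∫⁻ ω, visit u f ω n * extendZero f' (process t ω) ∂law π γ := by
    rw [← lintegral_tsum fun n => Measurable.aemeasurable
      (f := fun ω => visit u f ω n * extendZero f' (process t ω)) ((hv n).mul (hp.comp hpr))]
    refine lintegral_congr_ae ?_
    filter_upwards [ae_law_mono π γ] with ω hω
    rw [extendZero_process hω u f, ENNReal.tsum_mul_right]
  rw [h1]
  refine tsum_congr fun n => ?_
  have h2 : ∫⁻ ω, visit u f ω n * extendZero f' (process t ω) ∂law π γ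
      = ∫⁻ ω, extendZero (early u fun y => f y * f' y) (ω n) * late t (ω (n + 1)) ∂law π γ
        + ∑' k, ∫⁻ ω, visit u f ω n * visit t f' ω (n + 1 + k) ∂law π γ := by
    rw [← lintegral_tsum fun k => Measurable.aemeasurable
        (f := fun ω => visit u f ω n * visit t f' ω (n + 1 + k)) ((hv n).mul (hv' _)),
      ← lintegral_add_left (by fun_prop)]
    refine lintegral_congr_ae ?_
    filter_upwards [ae_law_mono π γ] with ω hω
    exact visit_mul_extendZero_process hω hut f f' n
  have h3 : ∑' k, ∫⁻ ω, visit u f ω n * visit t f' ω (n + 1 + k) ∂law π γ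
      = ∫⁻ ω, extendZero (early u f) (ω n) * (late u (ω (n + 1)) *
          extendZero (fun z => ∫⁻ w, alive π t f' w ∂occupation π z) (ω (n + 1))) ∂law π γ := by
    simp_rw [lintegral_law_visit_mul_visit π γ u t hf hf' n]
    rw [← lintegral_tsum fun k => Measurable.aemeasurable
      (f := fun ω => visit u f ω n
        * extendZero (fun z => ∫⁻ w, alive π t f' w ∂jumpIter π k z) (ω (n + 1)))
      ((hv n).mul ((measurable_extendZero (measurable_alive π t hf').lintegral_kernel).comp
        (measurable_pi_apply (n + 1))))]
    refine lintegral_congr fun ω => ?_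
    rw [ENNReal.tsum_mul_left, visit, mul_assoc]
    congr 2
    rcases ω (n + 1) with w | i
    · exact (lintegral_occupation π w _).symm
    · simp [extendZero]
  have h4 := lintegral_law_mul_succ π γ n
    (F := fun p => extendZero (early u fun y => f y * f' y) (p ⟨n, Finset.mem_Iic.2 le_rfl⟩))
    (by fun_prop) (hl t)
  have h5 := lintegral_law_mul_succ π γ n
    (F := fun p => extendZero (early u f) (p ⟨n, Finset.mem_Iic.2 le_rfl⟩))
    (by fun_prop) ((hl u).mul (measurable_extendZero hQ))
  rw [h2, h3]
  refine (congrArg₂ (· + ·) h4 h5).trans ?_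
  rw [← lintegral_add_left]
  · refine lintegral_congr fun ω => ?_
    change extendZero (early u fun y => f y * f' y) (ω n) * _ + extendZero (early u f) (ω n) * _ = _
    rcases ω n with w | i
    · change early u (fun y => f y * f' y) w * _ + early u f w * _ = alive π u (fun y => f y *
        ∫⁻ w, alive π t f' w ∂occupation π (u, y)) w
      rw [early, early, alive]
      split_ifs with h
      · simp only [Pi.mul_apply]
        -- The occupation kernel from (u, y) splits into its starting point, which is the event of
        -- no jump in (u, t], and the jumps after `u`. These are the two contributions on the left.
        rw [lintegral_nextMark_late π (h.trans hut), lintegral_nextMark_late_mul π h hQ,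
          lintegral_occupation_eq_add π _ (measurable_alive π t hf'), alive, if_pos hut,
          ← survival_mul π w.2 h hut]
        ring
      · simp
    · change 0 * _ + 0 * _ = (0 : ℝ≥0∞)
      simp
  · exact (hee.comp (measurable_pi_apply n)).mul
      ((hl t).lintegral_kernel.comp (measurable_pi_apply n))

end TwoTimes

/-! ### Identification of the transition function. -/

section Transition

theorem measurableEmbedding_inl {Ω : Type*} [MeasurableSpace Ω] :
    MeasurableEmbedding (Sum.inl : Ω → Ω ⊕ Unit) :=
  ⟨Sum.inl_injective, measurable_inl, fun _ hs => measurableSet_inl_image.2 hs⟩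

theorem extendZero_indicator_one {Ω : Type*} (B : Set Ω) :
    extendZero (B.indicator 1) = (Sum.inl '' B : Set (Ω ⊕ Unit)).indicator 1 := by
  ext m
  rcases m with y | i
  · change B.indicator 1 y = _
    by_cases hy : y ∈ B
    · rw [indicator_of_mem hy, indicator_of_mem (mem_image_of_mem _ hy)]; rfl
    · rw [indicator_of_notMem hy, indicator_of_notMem]
      rintro ⟨z, hz, hzy⟩
      exact hy (Sum.inl_injective hzy ▸ hz)
  · rw [indicator_of_notMem (by simp)]
    rfl

theorem lintegral_comap_inl {Ω : Type*} [MeasurableSpace Ω] (ν : Measure (Ω ⊕ Unit))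
    {f : Ω → ℝ≥0∞} (hf : Measurable f) :
    ∫⁻ y, f y ∂ν.comap Sum.inl = ∫⁻ m, extendZero f m ∂ν := by
  have h1 : ∫⁻ y, f y ∂ν.comap Sum.inl
      = ∫⁻ m, extendZero f m ∂(ν.comap Sum.inl).map Sum.inl := by
    rw [lintegral_map (measurable_extendZero hf) measurable_inl]
    rfl
  rw [h1, measurableEmbedding_inl.map_comap,
    ← lintegral_indicator measurableSet_range_inl]
  refine lintegral_congr fun m => ?_
  rcases m with y | i
  · exact indicator_of_mem (mem_range_self y) _
  · exact indicator_of_notMem (by simp) _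

theorem law_process_pair (γ : Measure S) [IsProbabilityMeasure γ] {u t : ℝ} (hut : u ≤ t)
    {B Γ : Set S} (hB : MeasurableSet B) (hΓ : MeasurableSet Γ) :
    law π γ {ω | process u ω ∈ Sum.inl '' B ∧ process t ω ∈ Sum.inl '' Γ}
      = ∫⁻ ω, extendZero (B.indicator fun y => ∫⁻ w, alive π t (Γ.indicator 1) w
          ∂occupation π (u, y)) (process u ω) ∂law π γ := by
  have hu := measurable_process (S := S) u
  have ht := measurable_process (S := S) t
  have hB' : MeasurableSet (Sum.inl '' B : Set (S ⊕ Unit)) := measurableSet_inl_image.2 hB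
  have hΓ' : MeasurableSet (Sum.inl '' Γ : Set (S ⊕ Unit)) := measurableSet_inl_image.2 hΓ
  have h := lintegral_law_process_mul_process π γ hut (measurable_one.indicator hB)
    (measurable_one.indicator hΓ)
  have h1 : (fun y => B.indicator (1 : S → ℝ≥0∞) y
      * ∫⁻ w, alive π t (Γ.indicator 1) w ∂occupation π (u, y))
      = B.indicator fun y => ∫⁻ w, alive π t (Γ.indicator 1) w ∂occupation π (u, y) := by
    ext y
    by_cases hy : y ∈ B <;> simp [hy]
  rw [h1] at h
  rw [← h]
  refine (lintegral_indicator_one ((hu hB').inter (ht hΓ'))).symm.trans ?_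
  refine lintegral_congr fun ω => ?_
  rw [extendZero_indicator_one, extendZero_indicator_one, inter_indicator_one]
  rfl

theorem measurableSet_singleton_inl (x : S) : MeasurableSet ({Sum.inl x} : Set (S ⊕ Unit)) := by
  rw [← image_singleton]
  exact measurableSet_inl_image.2 (measurableSet_singleton x)

theorem law_process_singleton (x : S) (u : ℝ) :
    law π (Measure.dirac x) (process u ⁻¹' {Sum.inl x})
      = ∫⁻ w, alive π u (({x} : Set S).indicator 1) w ∂occupation π (0, x) := by
  have hx : Measurable (({x} : Set S).indicator (1 : S → ℝ≥0∞)) :=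
    measurable_one.indicator (measurableSet_singleton x)
  have h1 := lintegral_law_process π (Measure.dirac x) u hx
  rw [lintegral_dirac' (f := fun y => ∫⁻ w, alive π u (({x} : Set S).indicator 1) w
    ∂occupation π (0, y)) _ ((measurable_lintegral_occupation_alive π u hx).comp
      (f := fun y : S => ((0 : ℝ), y)) (by fun_prop))] at h1
  rw [← h1, extendZero_indicator_one, image_singleton,
    ← lintegral_indicator_one (measurable_process u (measurableSet_singleton_inl x))]
  rfl

/-- The paths from `x` without a jump up to `u` already contribute the survival probability, an
exponential. -/
theorem law_process_singleton_pos (x : S) {u : ℝ} (hu : 0 ≤ u) :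
    0 < law π (Measure.dirac x) (process u ⁻¹' {Sum.inl x}) := by
  rw [law_process_singleton, lintegral_occupation_eq_add π _ (measurable_alive π u
    (measurable_one.indicator (measurableSet_singleton x)))]
  refine lt_of_lt_of_le (survival_pos π x 0 u) (le_add_right ?_)
  simp [alive, hu]

/-- By the Markov property with `B = {x}`, the joint probability is the occupation integral from (u,
x) times the probability of {ξ_u = x}; conditioning divides by that positive factor. -/
theorem transition_apply {u t : ℝ} (hu : 0 ≤ u) (hut : u ≤ t) (x : S) {Γ : Set S}
    (hΓ : MeasurableSet Γ) :
    transition π u x t Γ = ∫⁻ w, alive π t (Γ.indicator 1) w ∂occupation π (u, x) := by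
  have hΓ' : MeasurableSet (Sum.inl '' Γ : Set (S ⊕ Unit)) := measurableSet_inl_image.2 hΓ
  set μ := law π (Measure.dirac x) with hμ
  set D : Set (ℕ → Mark S) := process u ⁻¹' {Sum.inl x} with hD
  have hDm : MeasurableSet D := measurable_process u (measurableSet_singleton_inl x)
  set Q := ∫⁻ w, alive π t (Γ.indicator 1) w ∂occupation π (u, x) with hQ
  have h2 : μ (D ∩ process t ⁻¹' (Sum.inl '' Γ)) = Q * μ D := by
    have h := law_process_pair π (Measure.dirac x) hut (measurableSet_singleton x) hΓ
    rw [image_singleton] at h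
    refine h.trans ?_
    rw [← lintegral_indicator_const hDm]
    refine lintegral_congr fun ω => ?_
    by_cases hω : ω ∈ D
    · rw [indicator_of_mem hω, show process u ω = Sum.inl x from hω]
      simp [extendZero, hQ]
    · rw [indicator_of_notMem hω]
      have hne : process u ω ≠ Sum.inl x := hω
      revert hne
      generalize process u ω = m
      rintro hne
      rcases m with y | i
      · exact indicator_of_notMem (s := ({x} : Set S)) (fun hy : y = x => hne (hy ▸ rfl))
          fun y => ∫⁻ w, alive π t (Γ.indicator 1) w ∂occupation π (u, y)
      · rfl
  rw [transition, measurableEmbedding_inl.comap_apply, Measure.map_apply (measurable_process t) hΓ',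
    cond_apply hDm, h2, mul_comm Q, ← mul_assoc,
    ENNReal.inv_mul_cancel (law_process_singleton_pos π x hu).ne' (measure_ne_top _ _), one_mul]

theorem lintegral_transition {u t : ℝ} (hu : 0 ≤ u) (hut : u ≤ t) (x : S) {f : S → ℝ≥0∞}
    (hf : Measurable f) :
    ∫⁻ y, f y ∂transition π u x t = ∫⁻ w, alive π t f w ∂occupation π (u, x) := by
  have ha := measurable_alive π t (f := 1) measurable_one
  have hmul : ∀ (f : S → ℝ≥0∞) (w : ℝ × S), alive π t 1 w * f w.2 = alive π t f w := by
    intro f w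
    rw [alive, alive]
    split_ifs
    · rw [Pi.one_apply, one_mul, mul_comm]
    · rw [zero_mul]
  have h : transition π u x t
      = ((occupation π (u, x)).withDensity (alive π t 1)).map Prod.snd := by
    ext Γ hΓ
    have h1 : Measurable fun w : ℝ × S => Γ.indicator (1 : S → ℝ≥0∞) w.2 :=
      (measurable_one.indicator hΓ).comp measurable_snd
    rw [transition_apply π hu hut x hΓ, ← lintegral_indicator_one hΓ,
      lintegral_map (measurable_one.indicator hΓ) measurable_snd,
      lintegral_withDensity_eq_lintegral_mul _ ha h1]
    exact lintegral_congr fun w => (hmul _ w).symm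
  rw [h, lintegral_map hf measurable_snd,
    lintegral_withDensity_eq_lintegral_mul _ ha (g := fun w => f w.2) (hf.comp measurable_snd)]
  exact lintegral_congr fun w => hmul f w

/-- `IsSolution` demands measurability over all real `u`. For negative `u` the conditioning event is
null and `cond` is the zero measure, so `expectedCost` vanishes there. -/
theorem transition_of_neg {u : ℝ} (hu : u < 0) (x : S) (t : ℝ) : transition π u x t = 0 := by
  have h : law π (Measure.dirac x) (process u ⁻¹' {Sum.inl x}) = 0 := by
    rw [law_process_singleton]
    refine (lintegral_congr_ae ?_).trans lintegral_zero
    filter_upwards [ae_occupation_le π (0, x)] with w hw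
    exact if_neg (not_le.2 (hu.trans_le hw))
  rw [transition, cond_eq_zero_of_meas_eq_zero h]
  simp

theorem isTransitionFunction_transition : IsTransitionFunction π (transition π) := by
  intro u t hu hut
  refine ⟨fun x => ?_, fun Γ hΓ => ?_, fun γ hγ B Γ hB hΓ => ?_⟩
  · have hp : IsProbabilityMeasure (cond (law π (Measure.dirac x)) (process u ⁻¹' {Sum.inl x})) :=
      cond_isProbabilityMeasure (law_process_singleton_pos π x hu).ne'
    have hp' := Measure.isProbabilityMeasure_map (μ := cond (law π (Measure.dirac x))
      (process u ⁻¹' {Sum.inl x})) (measurable_process (S := S) t).aemeasurable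
    rw [transition, measurableEmbedding_inl.comap_apply]
    exact prob_le_one
  · simp_rw [transition_apply π hu hut _ hΓ]
    exact (measurable_lintegral_occupation_alive π t (measurable_one.indicator hΓ)).comp
      (f := fun y : S => (u, y)) (by fun_prop)
  · have hQ : Measurable (B.indicator fun y => ∫⁻ w, alive π t (Γ.indicator 1) w
        ∂occupation π (u, y)) :=
      ((measurable_lintegral_occupation_alive π t (measurable_one.indicator hΓ)).comp
        (f := fun y : S => (u, y)) (by fun_prop)).indicator hB
    simp_rw [transition_apply π hu hut _ hΓ]
    rw [law_process_pair π γ hut hB hΓ, ← lintegral_indicator hB, lintegral_comap_inl _ hQ,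
      lintegral_map (measurable_extendZero hQ) (measurable_process u)]

end Transition

/-! ### The cost as an occupation integral, and its minimality. -/

section Cost

/-- The expected cost up to the next jump, or up to `t`, after a jump `w`. -/
noncomputable def sojournCost (t : ℝ) (w : ℝ × S) : ℝ≥0∞ :=
  ∫⁻ s in Ioc w.1 t, survival π w.2 w.1 s * meanCost π w.2 s

theorem measurable_sojournCost_uncurry :
    Measurable fun p : (ℝ × S) × ℝ => sojournCost π p.2 p.1 := by
  have h1 : (fun p : (ℝ × S) × ℝ => sojournCost π p.2 p.1)
      = fun p => ∫⁻ s, {y : ((ℝ × S) × ℝ) × ℝ | y.1.1.1 < y.2 ∧ y.2 ≤ y.1.2}.indicator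
          (fun y => survival π y.1.1.2 y.1.1.1 y.2 * meanCost π y.1.1.2 y.2) (p, s) := by
    ext p
    rw [sojournCost, ← lintegral_indicator measurableSet_Ioc]
    rfl
  rw [h1]
  refine Measurable.lintegral_prod_right' (Measurable.indicator (Measurable.mul ?_ ?_) ?_)
  · exact (measurable_survival π).comp (f := fun y : ((ℝ × S) × ℝ) × ℝ => (y.1.1, y.2))
      (by fun_prop)
  · exact (measurable_meanCost π).comp (f := fun y : ((ℝ × S) × ℝ) × ℝ => (y.1.1.2, y.2))
      (by fun_prop)
  · exact (measurableSet_lt (f := fun y : ((ℝ × S) × ℝ) × ℝ => y.1.1.1) (g := fun y => y.2)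
      (by fun_prop) (by fun_prop)).inter
      (measurableSet_le (f := fun y : ((ℝ × S) × ℝ) × ℝ => y.2) (g := fun y => y.1.2)
      (by fun_prop) (by fun_prop))

theorem measurable_sojournCost (t : ℝ) : Measurable (sojournCost π t) :=
  (measurable_sojournCost_uncurry π).comp (f := fun w : ℝ × S => (w, t)) (by fun_prop)

theorem sojournCost_of_le {t : ℝ} {w : ℝ × S} (h : t ≤ w.1) : sojournCost π t w = 0 := by
  rw [sojournCost, Ioc_eq_empty (not_lt.2 h), Measure.restrict_empty, lintegral_zero_measure]

theorem expectedCost_eq {u : ℝ} (hu : 0 ≤ u) (x : S) (t : ℝ) :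
    expectedCost π u x t = ∫⁻ w, sojournCost π t w ∂occupation π (u, x) := by
  have h1 : expectedCost π u x t
      = ∫⁻ s in Ioc u t, ∫⁻ w, alive π s (fun y => meanCost π y s) w ∂occupation π (u, x) := by
    refine setLIntegral_congr_fun measurableSet_Ioc fun s hs => ?_
    exact lintegral_transition π hu hs.1.le x
      ((measurable_meanCost π).comp (f := fun y : S => (y, s)) (by fun_prop))
  have hm : Measurable (Function.uncurry fun s w => alive π s (fun y => meanCost π y s) w) :=
    (measurable_alive_uncurry π (measurable_meanCost π)).comp measurable_swap
  rw [h1, lintegral_lintegral_swap hm.aemeasurable]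
  refine lintegral_congr_ae ?_
  filter_upwards [ae_occupation_le π (u, x)] with w hw
  rw [sojournCost, ← lintegral_indicator measurableSet_Ioc, ← lintegral_indicator measurableSet_Ioc]
  -- `alive` includes the instant of the jump, whereas the half-open interval in `sojournCost`
  -- excludes it.
  have hne : ∀ᵐ s : ℝ, s ≠ w.1 := by simp [ae_iff]
  refine lintegral_congr_ae ?_
  filter_upwards [hne] with s hs
  simp only [indicator, mem_Ioc, alive]
  by_cases h1 : w.1 < s
  · simp [h1, h1.le, lt_of_le_of_lt hw h1, mul_comm]
  · simp [h1, not_le.2 (lt_of_le_of_ne (not_lt.1 h1) hs)]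

theorem expectedCost_of_neg {u : ℝ} (hu : u < 0) (x : S) (t : ℝ) : expectedCost π u x t = 0 := by
  simp [expectedCost, transition_of_neg π hu]

theorem expectedCost_of_le {u t : ℝ} (h : t ≤ u) (x : S) : expectedCost π u x t = 0 := by
  rw [expectedCost, Ioc_eq_empty (not_lt.2 h), Measure.restrict_empty, lintegral_zero_measure]

theorem measurable_expectedCost :
    Measurable fun p : ℝ × S × ℝ => expectedCost π p.1 p.2.1 p.2.2 := by
  have h : (fun p : ℝ × S × ℝ => expectedCost π p.1 p.2.1 p.2.2)
      = {p : ℝ × S × ℝ | 0 ≤ p.1}.indicator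
        fun p => ∫⁻ w, sojournCost π p.2.2 w ∂occupation π (p.1, p.2.1) := by
    ext p
    by_cases hp : 0 ≤ p.1
    · rw [indicator_of_mem (show p ∈ {p : ℝ × S × ℝ | 0 ≤ p.1} from hp), expectedCost_eq π hp]
    · rw [indicator_of_notMem (show p ∉ {p : ℝ × S × ℝ | 0 ≤ p.1} from hp),
        expectedCost_of_neg π (not_le.1 hp)]
  rw [h]
  refine Measurable.indicator ?_ (measurableSet_le measurable_const measurable_fst)
  exact Measurable.lintegral_kernel_prod_right'
    (κ := (occupation π).comap (fun p : ℝ × S × ℝ => (p.1, p.2.1)) (by fun_prop))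
    (f := fun q : (ℝ × S × ℝ) × (ℝ × S) => sojournCost π q.1.2.2 q.2)
    ((measurable_sojournCost_uncurry π).comp
      (f := fun q : (ℝ × S × ℝ) × (ℝ × S) => (q.2, q.1.2.2)) (by fun_prop))

theorem costOperator_eq_add (v : ℝ → S → ℝ → ℝ≥0∞) (u : ℝ) (x : S) (t : ℝ) :
    costOperator π v u x t = sojournCost π t (u, x)
      + ∫⁻ s in Ioc u t, survival π x u s * ∫⁻ y, v s y t ∂jumpRate π (x, s) := by
  have hc := measurable_meanCost_right π x
  -- Monotonicity gives measurability of the accumulated cost even where it is infinite.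
  have hmono : Monotone fun s => ∫⁻ θ in Ioc u s, meanCost π x θ := fun a b hab =>
    lintegral_mono_set (Ioc_subset_Ioc_right hab)
  have hm : Measurable fun s => survival π x u s *
      (meanRate π x s * ∫⁻ θ in Ioc u s, meanCost π x θ) :=
    (measurable_survival_right π x u).mul ((measurable_meanRate_right π x).mul hmono.measurable)
  simp_rw [costOperator, mul_add]
  rw [lintegral_add_left hm, ← add_assoc,
    lintegral_mul_survival_add π x hc]
  rfl

open Classical in
-- The form used for iteration: the running cost becomes that of the first sojourn, and the
-- remaining integral is taken over the first jump, cut off at `t`.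
theorem costOperator_eq_add_lintegral_jumpKernel {v : ℝ → S → ℝ → ℝ≥0∞}
    (hv : Measurable fun p : ℝ × S × ℝ => v p.1 p.2.1 p.2.2) (u : ℝ) (x : S) (t : ℝ) :
    costOperator π v u x t = sojournCost π t (u, x)
      + ∫⁻ w, (if w.1 ≤ t then v w.1 w.2 t else 0) ∂jumpKernel π (u, x) := by
  have hm : Measurable fun w : ℝ × S => if w.1 ≤ t then v w.1 w.2 t else 0 :=
    Measurable.ite (measurableSet_le measurable_fst measurable_const)
      (hv.comp (f := fun w : ℝ × S => (w.1, w.2, t)) (by fun_prop)) measurable_const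
  rw [costOperator_eq_add, lintegral_jumpKernel π _ hm]
  congr 1
  rw [← Ioi_inter_Iic, inter_comm, ← Measure.restrict_restrict measurableSet_Iic,
    ← lintegral_indicator measurableSet_Iic]
  refine lintegral_congr fun s => ?_
  by_cases hs : s ≤ t
  · rw [indicator_of_mem (show s ∈ Iic t from hs)]
    simp [hs]
  · rw [indicator_of_notMem (show s ∉ Iic t from hs)]
    simp [hs]

theorem isSolution_expectedCost : IsSolution π (expectedCost π) := by
  refine ⟨measurable_expectedCost π, fun u x t hu hut => le_of_eq ?_⟩
  rw [costOperator_eq_add_lintegral_jumpKernel π (measurable_expectedCost π),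
    expectedCost_eq π hu, lintegral_occupation_eq_add π _ (measurable_sojournCost π t)]
  congr 1
  refine lintegral_congr_ae ?_
  filter_upwards [ae_jumpKernel_lt π (u, x)] with w hw
  have hw0 : 0 ≤ w.1 := hu.trans (le_of_lt hw)
  split_ifs with h
  · exact expectedCost_eq π hw0 _ _
  -- A jump after `t` adds nothing, which agrees with the cut-off value 0.
  · exact (expectedCost_of_le π (not_le.1 h).le w.2).symm.trans (expectedCost_eq π hw0 _ _)

/-- The cost of the first n sojourns is at most `v`, by induction on n: the inequality splits off
the first sojourn, and the induction hypothesis applies after the first jump. The supremum over n is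
W^π. -/
theorem expectedCost_le_of_isSolution {v : ℝ → S → ℝ → ℝ≥0∞} (hv : IsSolution π v)
    {u : ℝ} (x : S) {t : ℝ} (hu : 0 ≤ u) (hut : u ≤ t) :
    expectedCost π u x t ≤ v u x t := by
  classical
  have hC := measurable_sojournCost π t
  have hI : ∀ k, Measurable fun z => ∫⁻ w, sojournCost π t w ∂jumpIter π k z :=
    fun k => hC.lintegral_kernel
  have h : ∀ n : ℕ, ∀ z : ℝ × S, 0 ≤ z.1 → z.1 ≤ t →
      ∑ k ∈ Finset.range n, ∫⁻ w, sojournCost π t w ∂jumpIter π k z ≤ v z.1 z.2 t := by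
    intro n
    induction n with
    | zero => intro z _ _; simp
    | succ n ih =>
      intro z hz hzt
      refine le_trans ?_ (hv.2 z.1 z.2 t hz hzt)
      rw [costOperator_eq_add_lintegral_jumpKernel π hv.1, Finset.sum_range_succ', add_comm,
        lintegral_jumpIter_zero π z hC]
      simp_rw [lintegral_jumpIter_succ π _ _ hC]
      rw [← lintegral_finsetSum _ fun k _ => hI k]
      refine add_le_add le_rfl (lintegral_mono_ae ?_)
      filter_upwards [ae_jumpKernel_lt π z] with w hw
      split_ifs with hwt
      · exact ih w (hz.trans (le_of_lt hw)) hwt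
      · refine le_of_eq (Finset.sum_eq_zero fun k _ => ?_)
        refine (lintegral_congr_ae ?_).trans lintegral_zero
        filter_upwards [ae_jumpIter_le π k w] with w' hw'
        exact sojournCost_of_le π ((not_le.1 hwt).le.trans hw')
  rw [expectedCost_eq π hu, lintegral_occupation]
  exact ENNReal.tsum_le_of_sum_range_le fun n => h n (u, x) hu hut

end Cost

/-! ### Stationary policies and the long-run average. -/

section AverageCost

theorem lintegral_jumpRate (x : S) (s : ℝ) {f : S → ℝ≥0∞} (hf : Measurable f) :
    ∫⁻ y, f y ∂jumpRate π (x, s) = ∫⁻ a, ∫⁻ y, f y ∂M.offDiag (x, a) ∂π.kernel (x, s) := by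
  rw [jumpRate, Kernel.lintegral_comp _ _ _ hf, Kernel.lintegral_prod _ _ _ hf.lintegral_kernel,
    Kernel.lintegral_deterministic'
      (f := fun y => ∫⁻ a, ∫⁻ b, f b ∂M.offDiag (y, a) ∂π.kernel (x, s))
      _ (hf.lintegral_kernel (κ := M.offDiag)).lintegral_prod_right']

/-- Joint measurability in path and time lets Tonelli be applied to the series of visits, which
replaces the process on almost every path. -/
theorem measurable_visit_uncurry {f : S × ℝ → ℝ≥0∞} (hf : Measurable f) (n : ℕ) :
    Measurable fun p : (ℕ → Mark S) × ℝ => visit p.2 (fun y => f (y, p.2)) p.1 n := by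
  have h1 : Measurable fun p : Mark S × ℝ => extendZero (early p.2 fun y => f (y, p.2)) p.1 := by
    have h0 : Measurable fun q : (ℝ × S) × ℝ => early q.2 (fun y => f (y, q.2)) q.1 :=
      Measurable.ite (measurableSet_le (by fun_prop) (by fun_prop))
        (hf.comp (f := fun q : (ℝ × S) × ℝ => (q.1.2, q.2)) (by fun_prop)) measurable_const
    have h3 : (fun p : Mark S × ℝ => extendZero (early p.2 fun y => f (y, p.2)) p.1)
        = extendZero (fun q : (ℝ × S) × ℝ => early q.2 (fun y => f (y, q.2)) q.1)
          ∘ Sum.map id (fun _ => ()) ∘ MeasurableEquiv.sumProdDistrib (ℝ × S) Unit ℝ := by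
      ext ⟨m, t⟩
      rcases m with w | i <;> rfl
    rw [h3]
    exact (measurable_extendZero h0).comp ((measurable_id.sumMap measurable_const).comp
      (MeasurableEquiv.measurable _))
  have h2 : Measurable fun p : Mark S × ℝ => late p.2 p.1 :=
    Measurable.ite (measurableSet_lt (measurable_coe_real_ereal.comp measurable_snd)
      (measurable_jumpTime.comp measurable_fst)) measurable_const measurable_const
  exact (h1.comp (f := fun p : (ℕ → Mark S) × ℝ => (p.1 n, p.2)) (by fun_prop)).mul
    (h2.comp (f := fun p : (ℕ → Mark S) × ℝ => (p.1 (n + 1), p.2)) (by fun_prop))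

theorem lintegral_law_cost (x : S) (T : ℝ) :
    ∫⁻ ω, (∫⁻ t in Ioc 0 T, Sum.elim (fun y => meanCost π y t) (fun _ => 0) (process t ω))
      ∂law π (Measure.dirac x) = expectedCost π 0 x T := by
  have hc : ∀ t, Measurable fun y => meanCost π y t := fun t =>
    (measurable_meanCost π).comp (f := fun y : S => (y, t)) (by fun_prop)
  have hv : Measurable fun p : (ℕ → Mark S) × ℝ =>
      ∑' n, visit p.2 (fun y => meanCost π y p.2) p.1 n :=
    Measurable.tsum fun n => measurable_visit_uncurry (measurable_meanCost π) n
  have h1 : ∫⁻ ω, (∫⁻ t in Ioc 0 T, Sum.elim (fun y => meanCost π y t) (fun _ => 0) (process t ω))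
        ∂law π (Measure.dirac x)
      = ∫⁻ ω, (∫⁻ t in Ioc 0 T, ∑' n, visit t (fun y => meanCost π y t) ω n)
        ∂law π (Measure.dirac x) := by
    refine lintegral_congr_ae ?_
    filter_upwards [ae_law_mono π (Measure.dirac x)] with ω hω
    exact lintegral_congr fun t => extendZero_process hω t _
  rw [h1, lintegral_lintegral_swap hv.aemeasurable, expectedCost]
  refine setLIntegral_congr_fun measurableSet_Ioc fun t ht => ?_
  have h2 : ∫⁻ ω, ∑' n, visit t (fun y => meanCost π y t) ω n ∂law π (Measure.dirac x)
      = ∫⁻ ω, extendZero (fun y => meanCost π y t) (process t ω) ∂law π (Measure.dirac x) := by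
    refine lintegral_congr_ae ?_
    filter_upwards [ae_law_mono π (Measure.dirac x)] with ω hω
    exact (extendZero_process hω t _).symm
  refine h2.trans ?_
  rw [lintegral_law_process π _ t (hc t), lintegral_transition π le_rfl ht.1.le x (hc t)]
  exact lintegral_dirac' _ ((measurable_lintegral_occupation_alive π t (hc t)).comp
    (f := fun y : S => ((0 : ℝ), y)) (by fun_prop))

/-- A solution of the stationary inequality yields a solution of the integral inequality. -/
theorem isSolution_stationary (π : M.StationaryPolicy) (g : ℝ≥0∞) {h : S → ℝ≥0∞}
    (hh : Measurable h)
    (hg : ∀ x, ∫⁻ a, M.c (x, a) ∂π.kernel x + ∫⁻ a, ∫⁻ y, h y ∂M.offDiag (x, a) ∂π.kernel x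
      ≤ g + h x * ∫⁻ a, M.rate x a ∂π.kernel x) :
    IsSolution π.toMarkov fun u x t => g * ENNReal.ofReal (t - u) + h x := by
  refine ⟨by fun_prop, fun u x t _ hut => ?_⟩
  set P := π.toMarkov
  set L := ∫⁻ a, M.rate x a ∂π.kernel x with hL
  set c := ∫⁻ a, (M.c (x, a) : ℝ≥0∞) ∂π.kernel x with hc
  set H := ∫⁻ a, ∫⁻ y, h y ∂M.offDiag (x, a) ∂π.kernel x with hH
  have hrate : ∀ s, meanRate P x s = L := fun s => rfl
  have hcost : ∀ s, meanCost P x s = c := fun s => rfl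
  have hjump : ∀ s, ∫⁻ y, h y ∂jumpRate P (x, s) = H := fun s => lintegral_jumpRate P x s hh
  have hs := measurable_survival_right P x u
  have h1 : ∀ s, ∫⁻ y, (g * ENNReal.ofReal (t - s) + h y) ∂jumpRate P (x, s)
      = g * ENNReal.ofReal (t - s) * L + H := fun s => by
    rw [lintegral_add_left measurable_const, lintegral_const, jumpRate_univ, hjump, hrate]
  have hsum := lintegral_survival_mul_meanRate_add P x hut
  have hparts := lintegral_mul_survival_add P x (φ := fun _ => g) measurable_const u t
  simp only [hrate, setLIntegral_const, Real.volume_Ioc] at hsum hparts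
  calc costOperator P (fun u x t => g * ENNReal.ofReal (t - u) + h x) u x t
      = ∫⁻ s in Ioc u t, (survival P x u s * c
          + survival P x u s * (g * ENNReal.ofReal (t - s) * L + H)) := by
        rw [costOperator_eq_add, lintegral_add_left (by fun_prop)]
        simp_rw [h1]
        rfl
    _ ≤ ∫⁻ s in Ioc u t, (survival P x u s * g
          + (h x * (survival P x u s * L)
            + survival P x u s * (g * ENNReal.ofReal (t - s) * L))) := by
        refine lintegral_mono fun s => ?_
        calc survival P x u s * c + survival P x u s * (g * ENNReal.ofReal (t - s) * L + H)
            = survival P x u s * (c + H)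
              + survival P x u s * (g * ENNReal.ofReal (t - s) * L) := by ring
          _ ≤ survival P x u s * (g + h x * L)
              + survival P x u s * (g * ENNReal.ofReal (t - s) * L) := by
            exact add_le_add (mul_le_mul' le_rfl (hg x)) le_rfl
          _ = _ := by ring
    -- Integration by parts, `hparts`, for the constant running cost `g`: paid continuously up to
    -- the jump, it equals g(s-u) paid at the jump, or g(t-u) at `t` if there is none.
    _ = g * ENNReal.ofReal (t - u) * survival P x u t
          + (∫⁻ s in Ioc u t, (survival P x u s * (L * (g * ENNReal.ofReal (s - u)))
            + survival P x u s * (g * ENNReal.ofReal (t - s) * L)))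
          + h x * ∫⁻ s in Ioc u t, survival P x u s * L := by
        rw [lintegral_add_left (by fun_prop), ← hparts, lintegral_add_left (by fun_prop),
          lintegral_const_mul _ (by fun_prop), lintegral_add_left (by fun_prop)]
        ring
    _ = g * ENNReal.ofReal (t - u) * survival P x u t
          + (∫⁻ s in Ioc u t, g * ENNReal.ofReal (t - u) * (survival P x u s * L))
          + h x * ∫⁻ s in Ioc u t, survival P x u s * L := by
        congr 2
        -- The elapsed part g(s-u) and the remaining part g(t-s) add up to g(t-u) whatever the jump
        -- time, so the total mass one of the holding time law yields exactly g(t-u).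
        refine setLIntegral_congr_fun measurableSet_Ioc fun s hs => ?_
        have : ENNReal.ofReal (t - u) = ENNReal.ofReal (s - u) + ENNReal.ofReal (t - s) := by
          rw [← ENNReal.ofReal_add (sub_nonneg.2 hs.1.le) (sub_nonneg.2 hs.2)]
          congr 1
          ring
        rw [this]
        ring
    _ = g * ENNReal.ofReal (t - u) + h x * ∫⁻ s in Ioc u t, survival P x u s * L := by
        rw [lintegral_const_mul _ (by fun_prop), ← mul_add, add_comm (survival P x u t), hsum,
          mul_one]
    -- The probability of a jump by `t` is at most one. Nothing is subtracted anywhere, so infinite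
    -- values of `g` and `h` are harmless.
    _ ≤ g * ENNReal.ofReal (t - u) + h x := by
        gcongr
        refine mul_le_of_le_one_right' ?_
        rw [← hsum]
        exact le_self_add

/-- Minimality at u = 0 bounds the average over (0, T] by g + h(x)/T; finiteness of h(x) makes the
last term vanish. -/
theorem averageCost_le_of_isSolution {g : ℝ≥0∞} {h : S → ℝ≥0∞}
    (hv : IsSolution π fun u x t => g * ENNReal.ofReal (t - u) + h x) {x : S} (hx : h x < ∞) :
    averageCost π x ≤ g := by
  have h1 : Tendsto (fun T : ℝ => g + h x / ENNReal.ofReal T) atTop (𝓝 g) := by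
    have h2 := ENNReal.Tendsto.const_div ENNReal.tendsto_ofReal_atTop (a := h x) (Or.inr hx.ne)
    rw [ENNReal.div_top] at h2
    simpa using tendsto_const_nhds.add h2
  refine le_trans (limsup_le_limsup ?_) h1.limsup_eq.le
  filter_upwards [eventually_gt_atTop 0] with T hT
  have h3 := expectedCost_le_of_isSolution π hv x le_rfl hT.le
  rw [sub_zero] at h3
  rw [lintegral_law_cost]
  refine (ENNReal.div_le_div_right h3 _).trans (le_of_eq ?_)
  rw [ENNReal.add_div, ENNReal.mul_div_cancel_right (ENNReal.ofReal_pos.2 hT).ne'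
    ENNReal.ofReal_ne_top]

end AverageCost

end CTMDP

theorem mainTheorem3 {S A : Type*} [MeasurableSpace S] [StandardBorelSpace S] [Nonempty S]
    [MeasurableSpace A] [StandardBorelSpace A] [Nonempty A] (M : CTMDP S A) :
    (∀ π : M.MarkovPolicy,
      CTMDP.IsTransitionFunction π (CTMDP.transition π) ∧
      CTMDP.IsSolution π (CTMDP.expectedCost π) ∧
      ∀ v : ℝ → S → ℝ → ℝ≥0∞, CTMDP.IsSolution π v →
        ∀ u x t, 0 ≤ u → u ≤ t → CTMDP.expectedCost π u x t ≤ v u x t) ∧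
    (∀ (π : M.StationaryPolicy) (g : ℝ≥0∞) (h : S → ℝ≥0∞), Measurable h →
      (∀ x, ∫⁻ a, M.c (x, a) ∂π.kernel x + ∫⁻ a, ∫⁻ y, h y ∂M.offDiag (x, a) ∂π.kernel x
        ≤ g + h x * ∫⁻ a, M.rate x a ∂π.kernel x) →
      ∀ x, h x < ∞ → CTMDP.averageCost π.toMarkov x ≤ g) :=
  ⟨fun π => ⟨CTMDP.isTransitionFunction_transition π, CTMDP.isSolution_expectedCost π,
      fun _ hv _ x _ hu hut => CTMDP.expectedCost_le_of_isSolution π hv x hu hut⟩,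
    fun π g _ hh hg _ hx =>
      CTMDP.averageCost_le_of_isSolution π.toMarkov (CTMDP.isSolution_stationary π g hh hg) hx⟩
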